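/- Let $v_1=(0,0)$, $v_2=(1,0)$, $v_3=(1/2,\sqrt3/2)$, $F_i(x)=\tfrac12(x+v_i)$ on $\mathbb R^2$, $V_0=\{v_1,v_2,v_3\}$, $V_{m+1}=\bigcup_iF_i(V_m)$, $\hat V_m=\bigcup_{k\ge0}2^k\,[V_{m+k}\cup(-V_{m+k})]$. Let $\mathbb S=\overline{\bigcup_mV_m}$ be the Sierpinski gasket and $\hat{\mathbb S}=\overline{\bigcup_m\hat V_m}$ the infinite gasket. Then $\hat{\mathbb S}$ is the union of countably many unit cells $\tau(\mathbb S)$, where $\tau$ runs over the isometries $x\mapsto\pm\big(x+\sum_{j\ge 0}2^jv_{f_j}\big)$, with $f_j\in\{1,2,3\}$ and $f_j=1$ for all but finitely many $j$. For a finite word $w=w_1\cdots w_m$ in $\{1,2,3\}$ put $F_w=F_{w_1}\circ\cdots\circ F_{w_m}$ and $\mathbf A_w=\mathbf A_{w_m}\cdots\mathbf A_{w_1}$ (with $F_\emptyset$, $\mathbf A_\emptyset$ the identities), where $$\mathbf A_1=\tfrac15\begin{pmatrix}5&0&0\\2&2&1\\2&1&2\end{pmatrix},\quad \mathbf A_2=\tfrac15\begin{pmatrix}2&2&1\\0&5&0\\1&2&2\end{pmatrix},\quad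 \mathbf A_3=\tfrac15\begin{pmatrix}2&1&2\\1&2&2\\0&0&5\end{pmatrix},$$ and let $\mathbf P x=x-\tfrac13(x_1+x_2+x_3)(1,1,1)$ on $\mathbb R^3$. There are Borel measures $\hat\nu$ (the Hausdorff measure) and $\hat\mu$ (the Kusuoka measure) on $\hat{\mathbb S}$, generated by the masses of the cells, such that for all $\tau$ and $w$ $$\hat\nu\big(\tau F_w(\mathbb S)\big)=3^{-|w|},\qquad \hat\mu\big(\tau F_w(\mathbb S)\big)=\tfrac12\,(5/3)^{|w|}\,\mathrm{tr}\big(\mathbf A_w^{\mathrm t}\mathbf P\mathbf A_w\big).$$ For $u\in C(\hat{\mathbb S})$ let $\hat{\mathcal E}(u)=\lim_{m\to\infty}\hat{\mathcal E}^{(m)}(u)\in[0,\infty]$ be the limit of the non-decreasing sequence $$\hat{\mathcal E}^{(m)}(u)=\tfrac12\,(5/3)^m\sum_{\tau}\ \sum_{|w|=m}\ \sum_{i,j=1}^{3}\big[u(\tau F_wv_i)-u(\tau F_wv_j)\big]^2 ,$$ and let $\mathcal F(\hat{\mathbb S})=\{u\in C(\hat{\mathbb S}):\hat{\mathcal E}(u)<\infty,\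 u\in L^2(\hat\nu)\}$. Define $\delta_s>0$ by $1/\delta_s=\log5/\log3-1$. For a Borel measure $\hat\sigma$ on $\hat{\mathbb S}$, exponents $p,q$, and real $b_1,\dots,b_N$, consider the inequality $$\|u\|_{L^q(\hat\sigma)}\le C\sum_{i=1}^N\hat{\mathcal E}(u)^{b_i/2}\,\|u\|_{L^p(\hat\nu)}^{1-b_i}\qquad\text{for all }u\in\mathcal F(\hat{\mathbb S}),\tag{$*$}$$ as an inequality in $[0,\infty]$ (with $0\cdot\infty=0$, $0^0=\infty^0=1$, $0^{s}=\infty$ and $\infty^{s}=0$ for $s<0$, and $1/\infty=0$). Let $1\le p\le q\le\infty$ and $q\ge2$. **(a)** Let $a=\dfrac{1/p-1/q}{1/p+1/(2\delta_s)}$. Then $a\in[0,1)$, and $(*)$ holds with $\hat\sigma=\hat\nu$, $N=2$ and $b_1=b_2=a$, with a constant $C$ that does not depend on $p$ and $q$. In particular, there is a constant $C$ such that for every $p\in[1,\infty]$, with $a_\infty=\dfrac{1/p}{1/p+1/(2\delta_s)}$, $$\sup_{\hat{\mathbb S}}|u|\le C\,\hat{\mathcal E}(u)^{a_\infty/2}\,\|u\|_{L^p(\hat\nu)}^{1-a_\infty},\qquad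 u\in\mathcal F(\hat{\mathbb S}).$$ Conversely, these exponents are the only admissible ones: for a real number $b$, $(*)$ holds with $\hat\sigma=\hat\nu$, $N=2$, $b_1=b_2=b$ and some finite $C$ if and only if $b=a$. More generally, for real $b_1,\dots,b_N$, $(*)$ holds with $\hat\sigma=\hat\nu$ and some finite $C$ if and only if $\min_ib_i\le a\le\max_ib_i$. **(b)** Let $$a_1=\Big[\frac{1/p-1/(q\delta_s)}{1/p+1/(2\delta_s)}\Big]^+,\qquad a_2=\Big[\frac{1/p-1/q}{1/p+1/(2\delta_s)}\Big]^+ .$$ Then $(*)$ holds with $\hat\sigma=\hat\mu$, $N=2$, $b_1=a_1$, $b_2=a_2$, with a constant $C$ that does not depend on $p$ and $q$. The pair $(a_1,a_2)$ is optimal: if $(*)$ holds with $\hat\sigma=\hat\mu$ for some real $b_1,\dots,b_N$ and some finite $C$, then $\min_ib_i\le a_2\le a_1\le\max_ib_i$. Moreover, write $[\omega]_m=\omega_1\cdots\omega_m$ for an infinite word $\omega=\omega_1\omega_2\cdots$ in $\{1,2,3\}$. Then $\limsup_{m\to\infty}\big[\mathrm{tr}(\mathbf A_{[\omega]_m}^{\mathrm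 t}\mathbf P\mathbf A_{[\omega]_m})\big]^{1/m}\le(3/5)^2$ for every $\omega$, and the supremum of $\lim_{m\to\infty}\big[\mathrm{tr}(\mathbf A_{[\omega]_m}^{\mathrm t}\mathbf P\mathbf A_{[\omega]_m})\big]^{1/m}$ over all $\omega$ for which this limit exists equals $(3/5)^2$. -/

import Mathlib

open MeasureTheory Filter Topology
open scoped ENNReal NNReal Pointwise

noncomputable section

namespace Sierpinski

/-- The plane `ℝ²` with the Euclidean metric. -/
abbrev Plane : Type := EuclideanSpace ℝ (Fin 2)

/-- The three corner points `(0,0)`, `(1,0)`, `(1/2, √3/2)`. -/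
def corner : Fin 3 → Plane :=
  ![!₂[(0 : ℝ), 0], !₂[(1 : ℝ), 0], !₂[(1 / 2 : ℝ), Real.sqrt 3 / 2]]

/-- The contractions `F_i(x) = (x + corner i) / 2`. -/
def F (i : Fin 3) (x : Plane) : Plane := (2 : ℝ)⁻¹ • (x + corner i)

/-- `F_w = F_{w₁} ∘ F_{w₂} ∘ ⋯ ∘ F_{w_m}` for a finite word `w`. -/
def Fword : List (Fin 3) → Plane → Plane
  | [] => id
  | i :: w => F i ∘ Fword w

/-- The vertex sets `V₀ = {corners}`, `V_{m+1} = ⋃ᵢ F_i(V_m)`. -/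
def V : ℕ → Set Plane
  | 0 => Set.range corner
  | m + 1 => ⋃ i, F i '' V m

/-- The compact Sierpinski gasket. -/
def Gasket : Set Plane := closure (⋃ m, V m)

/-- The vertex sets `⋃ₖ 2ᵏ (V_{m+k} ∪ -V_{m+k})` of the infinite gasket. -/
def Vhat (m : ℕ) : Set Plane := ⋃ k : ℕ, ((2 : ℝ) ^ k) • (V (m + k) ∪ -V (m + k))

/-- The infinite (two-sided) Sierpinski gasket. -/
def InfGasket : Set Plane := closure (⋃ m, Vhat m)

/-- Index set of the unit cells of the infinite gasket: a sign, which selects one of the two halves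
`⋃ₖ 2ᵏ S` and `-⋃ₖ 2ᵏ S`, and a finitely supported ternary expansion of the position. -/
abbrev TileIndex : Type := ℤˣ × (ℕ →₀ Fin 3)

/-- The isometry `x ↦ ± (x + ∑ⱼ 2ʲ corner (fⱼ))` which maps the compact gasket onto a unit cell.
The terms outside the support vanish because `corner 0 = 0`. -/
def tile (c : TileIndex) (x : Plane) : Plane :=
  (c.1 : ℤ) • (x + ∑ j ∈ c.2.support, ((2 : ℝ) ^ j) • corner (c.2 j))

theorem corner_zero : corner 0 = 0 := by
  ext i; fin_cases i <;> simp [corner]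

theorem corner_mem_V (i : Fin 3) : corner i ∈ V 0 := ⟨i, rfl⟩

theorem Fword_corner_mem (w : List (Fin 3)) (i : Fin 3) :
    Fword w (corner i) ∈ V w.length := by
  induction w with
  | nil => exact corner_mem_V i
  | cons a w ih => exact Set.mem_iUnion.2 ⟨a, _, ih, rfl⟩

theorem shift_mem (f : ℕ → Fin 3) (m : ℕ) (x : Plane) (hx : x ∈ V m) (k : ℕ) :
    ∃ y ∈ V (m + k), x + ∑ j ∈ Finset.range k, ((2 : ℝ) ^ j) • corner (f j) = (2 : ℝ) ^ k • y := by
  induction k with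
  | zero => exact ⟨x, hx, by simp⟩
  | succ k ih =>
    obtain ⟨y, hy, h⟩ := ih
    refine ⟨F (f k) y, Set.mem_iUnion.2 ⟨f k, y, hy, rfl⟩, ?_⟩
    rw [Finset.sum_range_succ, ← add_assoc, h, F, smul_smul, smul_add]
    congr 2 <;> · rw [pow_succ]; field_simp

theorem tile_vertex_mem (c : TileIndex) (w : List (Fin 3)) (i : Fin 3) :
    tile c (Fword w (corner i)) ∈ InfGasket := by
  apply subset_closure
  refine Set.mem_iUnion.2 ⟨w.length, ?_⟩
  obtain ⟨k, hk⟩ : ∃ k, c.2.support ⊆ Finset.range k := c.2.support.exists_nat_subset_range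
  have hsum : ∑ j ∈ c.2.support, ((2 : ℝ) ^ j) • corner (c.2 j)
      = ∑ j ∈ Finset.range k, ((2 : ℝ) ^ j) • corner (c.2 j) := by
    refine Finset.sum_subset hk fun j _ hj => ?_
    rw [Finsupp.notMem_support_iff.1 hj, corner_zero, smul_zero]
  obtain ⟨y, hy, h⟩ := shift_mem c.2 w.length _ (Fword_corner_mem w i) k
  refine Set.mem_iUnion.2 ⟨k, Set.mem_smul_set.2 ?_⟩
  rw [tile, hsum, h]
  rcases Int.units_eq_one_or c.1 with hc | hc
  · exact ⟨y, Or.inl hy, by simp [hc]⟩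
  · exact ⟨-y, Or.inr (by simpa using hy), by simp [hc]⟩

/-- The `i`-th corner of the cell `τ_c(F_w(S))`, as a point of the infinite gasket. -/
def vertex (c : TileIndex) (w : List (Fin 3)) (i : Fin 3) : InfGasket :=
  ⟨tile c (Fword w (corner i)), tile_vertex_mem c w i⟩

/-- The cell `τ_c(F_w(S))`, as a subset of the infinite gasket. -/
def cell (c : TileIndex) (w : List (Fin 3)) : Set InfGasket :=
  {x | (x : Plane) ∈ (fun y => tile c (Fword w y)) '' Gasket}

/-! ### Measures -/

/-- The Borel measure on the infinite gasket generated (by the metric Carathéodory construction,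
that is, through countable coverings by subsets of small cells) by the masses `wt w` of the cells
`τ_c(F_w(S))`. -/
def cellMeasure (wt : List (Fin 3) → ℝ≥0∞) : Measure InfGasket :=
  Measure.mkMetric' fun s => ⨅ (c : TileIndex) (w : List (Fin 3)) (_ : s ⊆ cell c w), wt w

/-- The Hausdorff measure: every cell `τ_c(F_w(S))` has mass `3^{-|w|}`. -/
def hausdorffHat : Measure InfGasket := cellMeasure fun w => (3 : ℝ≥0∞)⁻¹ ^ w.length

/-- The harmonic extension matrices `A₁, A₂, A₃`. -/
def A : Fin 3 → Matrix (Fin 3) (Fin 3) ℝ :=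
  ![(1 / 5 : ℝ) • !![5, 0, 0; 2, 2, 1; 2, 1, 2],
    (1 / 5 : ℝ) • !![2, 2, 1; 0, 5, 0; 1, 2, 2],
    (1 / 5 : ℝ) • !![2, 1, 2; 1, 2, 2; 0, 0, 5]]

/-- `A_w = A_{w_m} ⋯ A_{w₂} A_{w₁}`. -/
def Aword : List (Fin 3) → Matrix (Fin 3) (Fin 3) ℝ
  | [] => 1
  | i :: w => Aword w * A i

/-- The projection `P x = x - (x₁ + x₂ + x₃) / 3`. -/
def P : Matrix (Fin 3) (Fin 3) ℝ := 1 - Matrix.of fun _ _ => (1 / 3 : ℝ)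

/-- `tr (A_wᵗ P A_w)`. -/
def traceWord (w : List (Fin 3)) : ℝ := ((Aword w).transpose * P * Aword w).trace

/-- The mass `2⁻¹ (5/3)^{|w|} tr (A_wᵗ P A_w)` that the Kusuoka measure gives to `F_w(S)`. -/
def kusuokaWeight (w : List (Fin 3)) : ℝ := 2⁻¹ * (5 / 3) ^ w.length * traceWord w

/-- The Kusuoka measure: every cell `τ_c(F_w(S))` has mass `kusuokaWeight w`. -/
def kusuokaHat : Measure InfGasket := cellMeasure fun w => ENNReal.ofReal (kusuokaWeight w)

/-! ### The Dirichlet form -/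

/-- The energy at level `m`: the sum of `2⁻¹ (5/3)^m (u x - u y)²` over the ordered pairs `(x, y)`
of corners of a common cell of side length `2^{-m}`. -/
def energyLevel (m : ℕ) (u : C(InfGasket, ℝ)) : ℝ≥0∞ :=
  ∑' c : TileIndex, ∑ w : Fin m → Fin 3, ∑ i : Fin 3, ∑ j : Fin 3,
    ENNReal.ofReal (2⁻¹ * (5 / 3) ^ m *
      (u (vertex c (List.ofFn w) i) - u (vertex c (List.ofFn w) j)) ^ 2)

/-- The energy of `u`; the level energies are non-decreasing, so their limit is the supremum. -/
def energy (u : C(InfGasket, ℝ)) : ℝ≥0∞ := ⨆ m, energyLevel m u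

/-- The domain of the Dirichlet form: the continuous functions with finite energy and finite
`L²` norm. This space is already complete for the norm `energy^{1/2} + ‖·‖_{L²}`. -/
def domain : Set C(InfGasket, ℝ) := {u | energy u < ∞ ∧ MemLp u 2 hausdorffHat}

/-! ### Exponents and the inequality -/

/-- `1/δ_s = log 5 / log 3 - 1`. -/
def deltaS : ℝ := (Real.log 5 / Real.log 3 - 1)⁻¹

/-- `(1/p - 1/q) / (1/p + 1/(2 δ_s))`, with `1/∞ = 0`. -/
def expo (p q : ℝ≥0∞) : ℝ :=
  (p⁻¹.toReal - q⁻¹.toReal) / (p⁻¹.toReal + 1 / (2 * deltaS))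

/-- `[(1/p - 1/(q δ)) / (1/p + 1/(2 δ_s))]⁺`, with `1/∞ = 0`. -/
def expoPos (δ : ℝ) (p q : ℝ≥0∞) : ℝ :=
  max ((p⁻¹.toReal - q⁻¹.toReal / δ) / (p⁻¹.toReal + 1 / (2 * deltaS))) 0

/-- `‖u‖_{L^q(σ)} ≤ C ∑ᵢ energy(u)^{bᵢ/2} ‖u‖_{L^p(ν)}^{1 - bᵢ}` for all `u` in the domain, where
`ν` is the Hausdorff measure. -/
def SobolevIneq (σ : Measure InfGasket) (p q : ℝ≥0∞) {N : ℕ} (b : Fin N → ℝ) (C : ℝ≥0) : Prop :=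
  ∀ u ∈ domain, eLpNorm u q σ ≤
    C * ∑ i, energy u ^ (b i / 2) * eLpNorm u p hausdorffHat ^ (1 - b i)

/-- `[tr (A_{[ω]_m}ᵗ P A_{[ω]_m})]^{1/m}`, where `[ω]_m` consists of the first `m` letters. -/
def traceRoot (ω : ℕ → Fin 3) (m : ℕ) : ℝ :=
  traceWord (List.ofFn fun i : Fin m => ω i) ^ (1 / (m : ℝ))

end Sierpinski

end

/-! The inequalities come from one estimate on unit cells, transported to all scales by dilation.
The dilation `dil k`, multiplication by `2 ^ k`, maps the infinite gasket onto itself. Composition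
with it multiplies the energy by `(5/3) ^ k = 3 ^ (k / deltaS)` and the `L^p` norm for the Hausdorff
measure by `3 ^ (-k / p)`.

On a unit cell a function oscillates by at most a constant times the square root of its local energy
(`enorm_le_add_localEnergy`). Since the cell has Hausdorff mass one, the minimum of the absolute
value is at most the local `L^p` norm. Raising to the power `q` and summing over the cells, with the
embeddings of `ℓ^p` and `ℓ^2` into `ℓ^q`, gives `eLpNorm_le_unit_scale` for every measure whose unit
cells have bounded mass. Dilation turns it into a family indexed by `k` (`eLpNorm_le_scale`), in
which the measure enters only through a bound for its mass on cells of side `2 ^ (-k)`. Balancing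
the two terms by the choice of `k` yields a product of powers (`exists_le_of_forall_scale`). The
Hausdorff measure has mass `3 ^ (-k)` at every scale, hence one exponent. The Kusuoka measure has
mass at most `(3/5) ^ k` on small cells but exactly `3 ^ (-k)` on large ones, hence two. A Dirac
measure gives the bound for the maximum.

For necessity the inequality is tested on the dilates of a single function `tent`, harmonic on every
unit cell, as `k` tends to `±∞` (`exists_exponent_of_sobolevIneq`). For the Kusuoka measure this
needs a lower bound for small cells, found at a corner: there `A 0` has an eigenvector with
eigenvalue `3/5`, the same number that bounds the contraction of the form `quad` from above. The
growth rate of the traces follows from the same two facts.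

That the cells really have the prescribed masses (`IsMass.cellMeasure_cell`) is shown by comparison
with an outer measure on infinite words. -/

noncomputable section

namespace Sierpinski

/-! ### Harmonic extension matrices -/

/-- The quadratic form of `P`. -/
def quad (x : Fin 3 → ℝ) : ℝ :=
  x 0 ^ 2 + x 1 ^ 2 + x 2 ^ 2 - (x 0 + x 1 + x 2) ^ 2 / 3

theorem quad_eq (x : Fin 3 → ℝ) :
    quad x = ((x 0 - x 1) ^ 2 + (x 1 - x 2) ^ 2 + (x 0 - x 2) ^ 2) / 3 := by
  unfold quad; ring

theorem quad_nonneg (x : Fin 3 → ℝ) : 0 ≤ quad x := by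
  rw [quad_eq]; positivity

theorem trace_P_eq (M : Matrix (Fin 3) (Fin 3) ℝ) :
    (M.transpose * P * M).trace = ∑ j, quad fun i => M i j := by
  simp only [Matrix.trace, Matrix.diag, Matrix.mul_apply, Fin.sum_univ_three,
    Matrix.transpose_apply, P, quad, Matrix.sub_apply, Matrix.one_apply, Matrix.of_apply]
  norm_num [Fin.ext_iff]
  ring

theorem A_zero_mulVec (x : Fin 3 → ℝ) :
    (A 0).mulVec x = ![x 0, (2 * x 0 + 2 * x 1 + x 2) / 5, (2 * x 0 + x 1 + 2 * x 2) / 5] := by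
  ext i; fin_cases i <;> simp [A, Matrix.mulVec, dotProduct, Fin.sum_univ_three] <;> ring

theorem A_one_mulVec (x : Fin 3 → ℝ) :
    (A 1).mulVec x = ![(2 * x 0 + 2 * x 1 + x 2) / 5, x 1, (x 0 + 2 * x 1 + 2 * x 2) / 5] := by
  ext i; fin_cases i <;> simp [A, Matrix.mulVec, dotProduct, Fin.sum_univ_three] <;> ring

theorem A_two_mulVec (x : Fin 3 → ℝ) :
    (A 2).mulVec x = ![(2 * x 0 + x 1 + 2 * x 2) / 5, (x 0 + 2 * x 1 + 2 * x 2) / 5, x 2] := by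
  ext i; fin_cases i <;> simp [A, Matrix.mulVec, dotProduct, Fin.sum_univ_three] <;> ring

theorem A_mulVec_self (i : Fin 3) (x : Fin 3 → ℝ) : (A i).mulVec x i = x i := by
  fin_cases i <;> simp [A_zero_mulVec, A_one_mulVec, A_two_mulVec]

/-- Corner `j` of subcell `i` and corner `i` of subcell `j` are the same midpoint, so this symmetry
makes the harmonic extension single valued. -/
theorem A_mulVec_swap (i j : Fin 3) (x : Fin 3 → ℝ) :
    (A i).mulVec x j = (A j).mulVec x i := by
  fin_cases i <;> fin_cases j <;> simp [A_zero_mulVec, A_one_mulVec, A_two_mulVec]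

/-- Harmonic extension conserves the energy renormalized by `5/3`. This gives both the additivity of
the Kusuoka weights and the constant level energies of `tent`. -/
theorem sum_quad_A (x : Fin 3 → ℝ) :
    ∑ i, quad ((A i).mulVec x) = 3 / 5 * quad x := by
  simp only [Fin.sum_univ_three, A_zero_mulVec, A_one_mulVec, A_two_mulVec, quad]
  simp
  ring

/-- Modulo constants `A i` has the eigenvalues `3/5` and `1/5`, with eigenvectors symmetric and
antisymmetric under the reflection fixing corner `i`. They are orthogonal for `quad`, so the defect
is a multiple of a single square. -/
theorem quad_A_le (i : Fin 3) (x : Fin 3 → ℝ) :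
    quad ((A i).mulVec x) ≤ (3 / 5) ^ 2 * quad x := by
  fin_cases i
  · simp [A_zero_mulVec, quad]; nlinarith [sq_nonneg (x 1 - x 2)]
  · simp [A_one_mulVec, quad]; nlinarith [sq_nonneg (x 0 - x 2)]
  · simp [A_two_mulVec, quad]; nlinarith [sq_nonneg (x 0 - x 1)]

theorem Aword_append_singleton (w : List (Fin 3)) (i : Fin 3) :
    Aword (w ++ [i]) = A i * Aword w := by
  induction w with
  | nil => simp [Aword]
  | cons a w ih => simp [Aword, ih, mul_assoc]

theorem traceWord_eq (w : List (Fin 3)) : traceWord w = ∑ j, quad fun i => Aword w i j :=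
  trace_P_eq _

theorem traceWord_append (w : List (Fin 3)) (i : Fin 3) :
    traceWord (w ++ [i]) = ∑ j, quad ((A i).mulVec fun k => Aword w k j) := by
  rw [traceWord_eq, Aword_append_singleton]
  rfl

theorem traceWord_nil : traceWord [] = 2 := by
  rw [traceWord_eq]
  simp only [Aword, Fin.sum_univ_three, quad, Matrix.one_apply]
  norm_num [Fin.ext_iff]

theorem traceWord_nonneg (w : List (Fin 3)) : 0 ≤ traceWord w := by
  rw [traceWord_eq]; exact Finset.sum_nonneg fun _ _ => quad_nonneg _

theorem sum_traceWord (w : List (Fin 3)) :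
    ∑ i, traceWord (w ++ [i]) = 3 / 5 * traceWord w := by
  simp only [traceWord_append]
  rw [Finset.sum_comm, traceWord_eq, Finset.mul_sum]
  exact Finset.sum_congr rfl fun j _ => sum_quad_A _

theorem traceWord_le (w : List (Fin 3)) : traceWord w ≤ 2 * ((3 / 5) ^ 2) ^ w.length := by
  induction w using List.reverseRecOn with
  | nil => simp [traceWord_nil]
  | append_singleton w i ih =>
    have h : traceWord (w ++ [i]) ≤ (3 / 5) ^ 2 * traceWord w := by
      rw [traceWord_append, traceWord_eq, Finset.mul_sum]
      exact Finset.sum_le_sum fun j _ => quad_A_le _ _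
    rw [List.length_append, List.length_singleton, pow_succ]
    linarith

theorem Aword_replicate_mulVec (n : ℕ) :
    (Aword (List.replicate n 0)).mulVec ![0, 1, 1] = ![0, (3 / 5) ^ n, (3 / 5) ^ n] := by
  induction n with
  | zero => simp [Aword]
  | succ n ih =>
    rw [List.replicate_succ', Aword_append_singleton, ← Matrix.mulVec_mulVec, ih, A_zero_mulVec]
    ext i; fin_cases i <;> simp <;> ring

theorem le_traceWord_replicate (n : ℕ) :
    1 / 3 * ((3 / 5) ^ 2) ^ n ≤ traceWord (List.replicate n 0) := by
  have h := Aword_replicate_mulVec n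
  rw [traceWord_eq]
  set M := Aword (List.replicate n 0)
  have h0 := congrFun h 0
  have h1 := congrFun h 1
  have h2 := congrFun h 2
  simp [Matrix.mulVec, dotProduct, Fin.sum_univ_three] at h0 h1 h2
  have e : ((3 / 5 : ℝ) ^ 2) ^ n = ((3 / 5) ^ n) ^ 2 := by rw [← pow_mul, ← pow_mul, mul_comm]
  rw [e]
  set t := (3 / 5 : ℝ) ^ n
  simp only [Fin.sum_univ_three, quad_eq]
  -- Columns 1 and 2 of `M` add up to the image of the eigenvector `(0, 1, 1)`, so only the sum of
  -- two row differences is known. The sum of their squares is then at least half the square of that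
  -- sum.
  have key : ∀ a b : ℝ, a + b = -t → t ^ 2 / 2 ≤ a ^ 2 + b ^ 2 := fun a b hab => by
    rw [← neg_sq t, ← hab]; nlinarith [sq_nonneg (a - b)]
  have k1 := key (M 0 1 - M 1 1) (M 0 2 - M 1 2) (by linarith)
  have k2 := key (M 0 1 - M 2 1) (M 0 2 - M 2 2) (by linarith)
  linarith [sq_nonneg (M 0 0 - M 1 0), sq_nonneg (M 1 0 - M 2 0), sq_nonneg (M 0 0 - M 2 0),
    sq_nonneg (M 1 1 - M 2 1), sq_nonneg (M 1 2 - M 2 2)]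

/-! ### Masses of the Kusuoka measure -/

theorem kusuokaWeight_nonneg (w : List (Fin 3)) : 0 ≤ kusuokaWeight w :=
  mul_nonneg (by positivity) (traceWord_nonneg w)

theorem sum_kusuokaWeight (w : List (Fin 3)) :
    ∑ i, kusuokaWeight (w ++ [i]) = kusuokaWeight w := by
  simp only [kusuokaWeight, List.length_append, List.length_singleton]
  rw [← Finset.mul_sum, sum_traceWord, pow_succ]
  ring

theorem kusuokaWeight_le (w : List (Fin 3)) : kusuokaWeight w ≤ (3 / 5) ^ w.length := by
  have h := traceWord_le w
  have e : (3 / 5 : ℝ) ^ w.length = (5 / 3) ^ w.length * ((3 / 5) ^ 2) ^ w.length := by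
    rw [← mul_pow]; norm_num
  rw [kusuokaWeight, e, mul_assoc]
  have : (0 : ℝ) < (5 / 3) ^ w.length := by positivity
  nlinarith

/-- Along a corner the decay rate of `kusuokaWeight_le` is attained up to a constant; the optimality
of the exponent `expoPos deltaS p q` rests on this. -/
theorem le_kusuokaWeight_replicate (n : ℕ) :
    1 / 6 * (3 / 5) ^ n ≤ kusuokaWeight (List.replicate n 0) := by
  have h := le_traceWord_replicate n
  have e : (3 / 5 : ℝ) ^ n = (5 / 3) ^ n * ((3 / 5) ^ 2) ^ n := by
    rw [← mul_pow]; norm_num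
  rw [kusuokaWeight, List.length_replicate, e]
  have : (0 : ℝ) < (5 / 3) ^ n := by positivity
  nlinarith

/-! ### Growth of the traces -/

theorem tendsto_const_mul_pow_root {c r : ℝ} (hc : 0 < c) (hr : 0 ≤ r) :
    Tendsto (fun m : ℕ => (c * r ^ m) ^ (1 / (m : ℝ))) atTop (𝓝 r) := by
  have h1 : Tendsto (fun m : ℕ => c ^ (1 / (m : ℝ)) * r) atTop (𝓝 r) := by
    have : Tendsto (fun m : ℕ => c ^ (1 / (m : ℝ))) atTop (𝓝 (c ^ (0 : ℝ))) :=
      tendsto_const_nhds.rpow tendsto_one_div_atTop_nhds_zero_nat (Or.inl hc.ne')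
    simpa using this.mul_const r
  refine h1.congr' ?_
  filter_upwards [eventually_ne_atTop 0] with m hm
  rw [Real.mul_rpow hc.le (by positivity), one_div, Real.pow_rpow_inv_natCast hr hm]

theorem traceRoot_nonneg (ω : ℕ → Fin 3) (m : ℕ) : 0 ≤ traceRoot ω m :=
  Real.rpow_nonneg (traceWord_nonneg _) _

theorem traceRoot_le (ω : ℕ → Fin 3) (m : ℕ) :
    traceRoot ω m ≤ (2 * ((3 / 5) ^ 2) ^ m) ^ (1 / (m : ℝ)) := by
  refine Real.rpow_le_rpow (traceWord_nonneg _) ?_ (by positivity)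
  simpa using traceWord_le (List.ofFn fun i : Fin m => ω i)

theorem limsup_traceRoot_le (ω : ℕ → Fin 3) : limsup (traceRoot ω) atTop ≤ (3 / 5) ^ 2 := by
  have h := tendsto_const_mul_pow_root (c := 2) (r := (3 / 5) ^ 2) (by norm_num) (by positivity)
  rw [← h.limsup_eq]
  refine limsup_le_limsup (Eventually.of_forall (traceRoot_le ω)) ?_ h.isBoundedUnder_le
  exact IsCoboundedUnder.of_frequently_ge (a := 0)
    (Eventually.frequently (Eventually.of_forall (traceRoot_nonneg ω)))

theorem tendsto_traceRoot_zero :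
    Tendsto (traceRoot fun _ => 0) atTop (𝓝 ((3 / 5) ^ 2)) := by
  refine tendsto_of_tendsto_of_tendsto_of_le_of_le
    (tendsto_const_mul_pow_root (c := 1 / 3) (r := (3 / 5) ^ 2) (by norm_num) (by positivity))
    (tendsto_const_mul_pow_root (c := 2) (r := (3 / 5) ^ 2) (by norm_num) (by positivity))
    (fun m => ?_) (traceRoot_le _)
  refine Real.rpow_le_rpow (by positivity) ?_ (by positivity)
  rw [List.ofFn_const]
  exact le_traceWord_replicate m

theorem isLUB_traceRoot :
    IsLUB {L : ℝ | ∃ ω : ℕ → Fin 3, Tendsto (traceRoot ω) atTop (𝓝 L)} ((3 / 5) ^ 2) := by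
  refine ⟨?_, fun b hb => hb ⟨_, tendsto_traceRoot_zero⟩⟩
  rintro L ⟨ω, h⟩
  exact h.limsup_eq ▸ limsup_traceRoot_le ω

/-! ### Lattice coordinates -/

/-- The first coordinate with respect to the basis `corner 1`, `corner 2`. -/
def latA (x : Plane) : ℝ := x 0 - x 1 / Real.sqrt 3

/-- The second coordinate with respect to the basis `corner 1`, `corner 2`. -/
def latB (x : Plane) : ℝ := 2 * x 1 / Real.sqrt 3

theorem latA_add (x y : Plane) : latA (x + y) = latA x + latA y := by simp [latA]; ring
theorem latB_add (x y : Plane) : latB (x + y) = latB x + latB y := by simp [latB]; ring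
theorem latA_smul (r : ℝ) (x : Plane) : latA (r • x) = r * latA x := by simp [latA]; ring
theorem latB_smul (r : ℝ) (x : Plane) : latB (r • x) = r * latB x := by simp [latB]; ring
theorem latA_zsmul (r : ℤ) (x : Plane) : latA (r • x) = r * latA x := by
  rw [← latA_smul, Int.cast_smul_eq_zsmul]
theorem latB_zsmul (r : ℤ) (x : Plane) : latB (r • x) = r * latB x := by
  rw [← latB_smul, Int.cast_smul_eq_zsmul]

theorem latA_sum {ι : Type*} (s : Finset ι) (f : ι → Plane) :
    latA (∑ i ∈ s, f i) = ∑ i ∈ s, latA (f i) :=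
  map_sum (AddMonoidHom.mk' latA latA_add) f s

theorem latB_sum {ι : Type*} (s : Finset ι) (f : ι → Plane) :
    latB (∑ i ∈ s, f i) = ∑ i ∈ s, latB (f i) :=
  map_sum (AddMonoidHom.mk' latB latB_add) f s

theorem continuous_latA : Continuous latA := by unfold latA; fun_prop
theorem continuous_latB : Continuous latB := by unfold latB; fun_prop

theorem sqrt_three_ne_zero : Real.sqrt 3 ≠ 0 := by positivity

theorem latA_corner (i : Fin 3) : latA (corner i) = if i = 1 then 1 else 0 := by
  have := sqrt_three_ne_zero
  fin_cases i <;> simp [latA, corner]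
  field_simp; norm_num

theorem latB_corner (i : Fin 3) : latB (corner i) = if i = 2 then 1 else 0 := by
  have := sqrt_three_ne_zero
  fin_cases i <;> simp [latB, corner]
  field_simp

theorem ext_lat {x y : Plane} (ha : latA x = latA y) (hb : latB x = latB y) : x = y := by
  have h3 := sqrt_three_ne_zero
  unfold latA at ha
  unfold latB at hb
  have h1 : x 1 = y 1 := by field_simp at hb; linarith
  have h0 : x 0 = y 0 := by rw [h1] at ha; linarith
  ext i; fin_cases i
  · exact h0
  · exact h1

theorem corner_injective : Function.Injective corner := by
  intro i j h
  have ha := congrArg latA h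
  have hb := congrArg latB h
  rw [latA_corner, latA_corner] at ha
  rw [latB_corner, latB_corner] at hb
  fin_cases i <;> fin_cases j <;> simp_all

/-- The closed triangle spanned by the corners. -/
def Triangle : Set Plane := {x | 0 ≤ latA x ∧ 0 ≤ latB x ∧ latA x + latB x ≤ 1}

theorem isClosed_triangle : IsClosed Triangle :=
  (isClosed_le continuous_const continuous_latA).inter
    ((isClosed_le continuous_const continuous_latB).inter
      (isClosed_le (continuous_latA.add continuous_latB) continuous_const))

theorem corner_mem_triangle (i : Fin 3) : corner i ∈ Triangle := by
  rw [Triangle, Set.mem_ofPred_eq, latA_corner, latB_corner]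
  fin_cases i <;> simp

theorem latA_F (i : Fin 3) (x : Plane) : latA (F i x) = (latA x + if i = 1 then 1 else 0) / 2 := by
  rw [F, latA_smul, latA_add, latA_corner]; ring

theorem latB_F (i : Fin 3) (x : Plane) : latB (F i x) = (latB x + if i = 2 then 1 else 0) / 2 := by
  rw [F, latB_smul, latB_add, latB_corner]; ring

theorem F_mem_triangle (i : Fin 3) {x : Plane} (hx : x ∈ Triangle) : F i x ∈ Triangle := by
  obtain ⟨h1, h2, h3⟩ := hx
  rw [Triangle, Set.mem_ofPred_eq, latA_F, latB_F]
  fin_cases i <;> simp <;> refine ⟨?_, ?_, ?_⟩ <;> linarith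

theorem F_corner_self (i : Fin 3) : F i (corner i) = corner i := by
  rw [F, ← two_smul ℝ, smul_smul]; norm_num

theorem eq_of_F_eq_corner {i j : Fin 3} {x : Plane} (hx : x ∈ Triangle) (h : F i x = corner j) :
    i = j := by
  obtain ⟨h1, h2, h3⟩ := hx
  have ha := congrArg latA h
  have hb := congrArg latB h
  rw [latA_F, latA_corner] at ha
  rw [latB_F, latB_corner] at hb
  fin_cases i <;> fin_cases j <;> simp at ha hb ⊢ <;> linarith

theorem F_injective (i : Fin 3) : Function.Injective (F i) := by
  intro x y h
  simpa [F] using h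

theorem F_corner_eq {i i' j j' : Fin 3} (h : F i (corner j) = F i' (corner j')) :
    (i = i' ∧ j = j') ∨ (i = j' ∧ j = i') := by
  have ha := congrArg latA h
  have hb := congrArg latB h
  rw [latA_F, latA_F, latA_corner, latA_corner] at ha
  rw [latB_F, latB_F, latB_corner, latB_corner] at hb
  revert ha hb
  clear h
  fin_cases i <;> fin_cases i' <;> fin_cases j <;> fin_cases j' <;> norm_num [Fin.ext_iff]

theorem norm_le_one_of_mem_triangle {x : Plane} (hx : x ∈ Triangle) : ‖x‖ ≤ 1 := by
  obtain ⟨h1, h2, h3⟩ := hx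
  have h := sqrt_three_ne_zero
  have hs : Real.sqrt 3 ^ 2 = 3 := Real.sq_sqrt (by norm_num)
  have e1 : x 1 = Real.sqrt 3 / 2 * latB x := by unfold latB; field_simp
  have e0 : x 0 = latA x + latB x / 2 := by unfold latA latB; field_simp; ring
  rw [EuclideanSpace.norm_eq, Real.sqrt_le_iff, Fin.sum_univ_two, Real.norm_eq_abs,
    Real.norm_eq_abs, sq_abs, sq_abs, e0, e1, mul_pow, div_pow, hs]
  constructor <;> nlinarith

/-! ### The compact gasket -/

theorem continuous_F (i : Fin 3) : Continuous (F i) := by unfold F; fun_prop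

theorem continuous_Fword (w : List (Fin 3)) : Continuous (Fword w) := by
  induction w with
  | nil => exact continuous_id
  | cons i w ih => exact (continuous_F i).comp ih

theorem V_subset_triangle (m : ℕ) : V m ⊆ Triangle := by
  induction m with
  | zero => rintro _ ⟨i, rfl⟩; exact corner_mem_triangle i
  | succ m ih =>
    refine Set.iUnion_subset fun i => ?_
    rintro _ ⟨x, hx, rfl⟩
    exact F_mem_triangle i (ih hx)

theorem gasket_subset_triangle : Gasket ⊆ Triangle :=
  closure_minimal (Set.iUnion_subset V_subset_triangle) isClosed_triangle

theorem isClosed_gasket : IsClosed Gasket := isClosed_closure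

theorem isCompact_gasket : IsCompact Gasket := by
  refine Metric.isCompact_of_isClosed_isBounded isClosed_gasket ?_
  refine (Metric.isBounded_closedBall (x := (0 : Plane)) (r := 1)).subset fun x hx => ?_
  simpa using norm_le_one_of_mem_triangle (gasket_subset_triangle hx)

theorem corner_mem_gasket (i : Fin 3) : corner i ∈ Gasket :=
  subset_closure (Set.mem_iUnion.2 ⟨0, corner_mem_V i⟩)

theorem F_mem_gasket (i : Fin 3) {x : Plane} (hx : x ∈ Gasket) : F i x ∈ Gasket := by
  refine map_mem_closure (continuous_F i) hx fun y hy => ?_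
  obtain ⟨m, hm⟩ := Set.mem_iUnion.1 hy
  exact Set.mem_iUnion.2 ⟨m + 1, Set.mem_iUnion.2 ⟨i, y, hm, rfl⟩⟩

theorem Fword_mem_gasket (w : List (Fin 3)) {x : Plane} (hx : x ∈ Gasket) :
    Fword w x ∈ Gasket := by
  induction w with
  | nil => exact hx
  | cons i w ih => exact F_mem_gasket i ih

theorem exists_F_eq {x : Plane} (hx : x ∈ Gasket) : ∃ i, ∃ y ∈ Gasket, F i y = x := by
  have hcl : IsClosed (⋃ i, F i '' Gasket) :=
    isClosed_iUnion_of_finite fun i => (isCompact_gasket.image (continuous_F i)).isClosed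
  have hsub : Gasket ⊆ ⋃ i, F i '' Gasket := by
    refine closure_minimal (Set.iUnion_subset fun m => ?_) hcl
    cases m with
    | zero =>
      rintro _ ⟨i, rfl⟩
      exact Set.mem_iUnion.2 ⟨i, _, corner_mem_gasket i, F_corner_self i⟩
    | succ m =>
      refine Set.iUnion_subset fun i => ?_
      rintro _ ⟨y, hy, rfl⟩
      exact Set.mem_iUnion.2 ⟨i, y, subset_closure (Set.mem_iUnion.2 ⟨m, hy⟩), rfl⟩
  simpa using hsub hx

theorem Fword_append (v w : List (Fin 3)) (x : Plane) :
    Fword (v ++ w) x = Fword v (Fword w x) := by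
  induction v with
  | nil => rfl
  | cons i v ih => simp [Fword, ih]

theorem exists_Fword_eq (n : ℕ) {x : Plane} (hx : x ∈ Gasket) :
    ∃ w : List (Fin 3), w.length = n ∧ ∃ y ∈ Gasket, Fword w y = x := by
  induction n generalizing x with
  | zero => exact ⟨[], rfl, x, hx, rfl⟩
  | succ n ih =>
    obtain ⟨i, y, hy, rfl⟩ := exists_F_eq hx
    obtain ⟨w, hw, z, hz, rfl⟩ := ih hy
    exact ⟨i :: w, by simp [hw], z, hz, rfl⟩

theorem exists_Fword_of_mem_V {n : ℕ} {x : Plane} (hx : x ∈ V n) :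
    ∃ w : List (Fin 3), w.length = n ∧ ∃ i, x = Fword w (corner i) := by
  induction n generalizing x with
  | zero => obtain ⟨i, rfl⟩ := hx; exact ⟨[], rfl, i, rfl⟩
  | succ n ih =>
    obtain ⟨i, y, hy, rfl⟩ := Set.mem_iUnion.1 hx
    obtain ⟨w, hw, j, rfl⟩ := ih hy
    exact ⟨i :: w, by simp [hw], j, rfl⟩

theorem Fword_replicate_corner (n : ℕ) (i : Fin 3) :
    Fword (List.replicate n i) (corner i) = corner i := by
  induction n with
  | zero => rfl
  | succ n ih => rw [List.replicate_succ, Fword, Function.comp, ih, F_corner_self]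

theorem dist_Fword (w : List (Fin 3)) (x y : Plane) :
    dist (Fword w x) (Fword w y) = (1 / 2) ^ w.length * dist x y := by
  induction w with
  | nil => simp [Fword]
  | cons i w ih =>
    simp only [Fword, Function.comp, F, dist_smul₀, dist_add_right, ih, List.length_cons, pow_succ]
    norm_num
    ring

/-! ### Positions of the unit cells -/

/-- The translation vector of a unit cell. -/
def shift (f : ℕ →₀ Fin 3) : Plane := ∑ j ∈ f.support, ((2 : ℝ) ^ j) • corner (f j)

theorem tile_eq (c : TileIndex) (x : Plane) : tile c x = (c.1 : ℤ) • (x + shift c.2) := rfl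

theorem shift_eq_range {f : ℕ →₀ Fin 3} {k : ℕ} (hk : f.support ⊆ Finset.range k) :
    shift f = ∑ j ∈ Finset.range k, ((2 : ℝ) ^ j) • corner (f j) := by
  refine Finset.sum_subset hk fun j _ hj => ?_
  rw [Finsupp.notMem_support_iff.1 hj, corner_zero, smul_zero]

/-- The first lattice coordinate of a unit cell. -/
def shiftA (f : ℕ →₀ Fin 3) : ℕ := ∑ j ∈ f.support.filter (fun j => f j = 1), 2 ^ j

/-- The second lattice coordinate of a unit cell. -/
def shiftB (f : ℕ →₀ Fin 3) : ℕ := ∑ j ∈ f.support.filter (fun j => f j = 2), 2 ^ j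

theorem latA_shift (f : ℕ →₀ Fin 3) : latA (shift f) = shiftA f := by
  simp [shift, shiftA, latA_sum, latA_smul, latA_corner, Finset.sum_filter]

theorem latB_shift (f : ℕ →₀ Fin 3) : latB (shift f) = shiftB f := by
  simp [shift, shiftB, latB_sum, latB_smul, latB_corner, Finset.sum_filter]

/-- The places of the digits 1 and 2 are the binary expansions of the two coordinates, so the
position determines all digits. -/
theorem shiftAB_injective {f g : ℕ →₀ Fin 3} (ha : shiftA f = shiftA g)
    (hb : shiftB f = shiftB g) : f = g := by
  have h1 := Finset.ext_iff.1 (Finset.geomSum_injective le_rfl ha)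
  have h2 := Finset.ext_iff.1 (Finset.geomSum_injective le_rfl hb)
  ext j : 1
  have h1 := h1 j
  have h2 := h2 j
  simp only [Finset.mem_filter, Finsupp.mem_support_iff] at h1 h2
  generalize f j = a at *
  generalize g j = b at *
  revert h1 h2
  revert a b
  decide

theorem eq_corner_of_lat {x : Plane} (hx : x ∈ Triangle) (ha : latA x = 0 ∨ latA x = 1)
    (hb : latB x = 0 ∨ latB x = 1) : ∃ j, x = corner j := by
  obtain ⟨-, -, h⟩ := hx
  rcases ha with ha | ha <;> rcases hb with hb | hb
  · exact ⟨0, ext_lat (by rw [latA_corner, ha]; simp) (by rw [latB_corner, hb]; simp)⟩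
  · exact ⟨2, ext_lat (by rw [latA_corner, ha]; simp) (by rw [latB_corner, hb]; simp)⟩
  · exact ⟨1, ext_lat (by rw [latA_corner, ha]; simp) (by rw [latB_corner, hb]; simp)⟩
  · rw [ha, hb] at h; norm_num at h

/-- Distinct unit cells on the same side differ by a nonzero integer vector `(s, t)`. A common point
forces both entries into `{-1, 0, 1}`, and in each remaining case the triangle inequalities are
tight or contradictory. -/
theorem add_shift_eq {f g : ℕ →₀ Fin 3} (hfg : f ≠ g) {x y : Plane} (hx : x ∈ Triangle)
    (hy : y ∈ Triangle) (h : x + shift f = y + shift g) :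
    (∃ j, x = corner j) ∧ ∃ j, y = corner j := by
  have ha := congrArg latA h
  have hb := congrArg latB h
  rw [latA_add, latA_add, latA_shift, latA_shift] at ha
  rw [latB_add, latB_add, latB_shift, latB_shift] at hb
  obtain ⟨s, hs⟩ : ∃ s : ℤ, s = (shiftA g : ℤ) - shiftA f := ⟨_, rfl⟩
  obtain ⟨t, ht⟩ : ∃ t : ℤ, t = (shiftB g : ℤ) - shiftB f := ⟨_, rfl⟩
  have hs' : (s : ℝ) = latA x - latA y := by rw [hs]; push_cast; linarith
  have ht' : (t : ℝ) = latB x - latB y := by rw [ht]; push_cast; linarith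
  have hst : ¬ (s = 0 ∧ t = 0) := fun ⟨h1, h2⟩ => hfg (shiftAB_injective (by omega) (by omega))
  have hx' := hx
  have hy' := hy
  obtain ⟨x1, x2, x3⟩ := hx
  obtain ⟨y1, y2, y3⟩ := hy
  have s1 : s ≤ 1 := by have : (s : ℝ) ≤ 1 := by linarith
                        exact_mod_cast this
  have s2 : -1 ≤ s := by have : (-1 : ℝ) ≤ s := by linarith
                         exact_mod_cast this
  have t1 : t ≤ 1 := by have : (t : ℝ) ≤ 1 := by linarith
                        exact_mod_cast this
  have t2 : -1 ≤ t := by have : (-1 : ℝ) ≤ t := by linarith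
                         exact_mod_cast this
  have key : (latA x = 0 ∨ latA x = 1) ∧ (latB x = 0 ∨ latB x = 1) ∧
      (latA y = 0 ∨ latA y = 1) ∧ (latB y = 0 ∨ latB y = 1) := by
    have e0 : ∀ {z : ℝ}, 0 ≤ z → z ≤ 0 → z = 0 ∨ z = 1 := fun h1 h2 => Or.inl (le_antisymm h2 h1)
    have e1 : ∀ {z : ℝ}, 1 ≤ z → z ≤ 1 → z = 0 ∨ z = 1 := fun h1 h2 => Or.inr (le_antisymm h2 h1)
    interval_cases s <;> interval_cases t <;> norm_num at hs' ht' hst <;>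
      refine ⟨?_, ?_, ?_, ?_⟩ <;>
      first
      | exact e0 (by linarith) (by linarith)
      | exact e1 (by linarith) (by linarith)
  exact ⟨eq_corner_of_lat hx' key.1 key.2.1, eq_corner_of_lat hy' key.2.2.1 key.2.2.2⟩

theorem add_shift_eq_neg {f g : ℕ →₀ Fin 3} {x y : Plane} (hx : x ∈ Triangle)
    (hy : y ∈ Triangle) (h : x + shift f = -(y + shift g)) :
    x = corner 0 ∧ y = corner 0 := by
  have e : x + shift f + (y + shift g) = (0 : ℝ) • (0 : Plane) := by rw [h]; simp
  have ha := congrArg latA e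
  have hb := congrArg latB e
  rw [latA_add, latA_add, latA_add, latA_shift, latA_shift, latA_smul, zero_mul] at ha
  rw [latB_add, latB_add, latB_add, latB_shift, latB_shift, latB_smul, zero_mul] at hb
  obtain ⟨x1, x2, -⟩ := hx
  obtain ⟨y1, y2, -⟩ := hy
  have n1 : (0 : ℝ) ≤ shiftA f := Nat.cast_nonneg _
  have n2 : (0 : ℝ) ≤ shiftA g := Nat.cast_nonneg _
  have n3 : (0 : ℝ) ≤ shiftB f := Nat.cast_nonneg _
  have n4 : (0 : ℝ) ≤ shiftB g := Nat.cast_nonneg _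
  constructor <;> apply ext_lat <;> 
    simp only [latA_corner, latB_corner, Fin.reduceEq, if_false] <;> linarith

theorem tile_eq_tile {c c' : TileIndex} (hc : c ≠ c') {x y : Plane} (hx : x ∈ Triangle)
    (hy : y ∈ Triangle) (h : tile c x = tile c' y) :
    (∃ j, x = corner j) ∧ ∃ j, y = corner j := by
  obtain ⟨s, f⟩ := c
  obtain ⟨s', g⟩ := c'
  simp only [tile_eq] at h
  rcases Int.units_eq_one_or s with rfl | rfl <;> rcases Int.units_eq_one_or s' with rfl | rfl
  · exact add_shift_eq (f := f) (g := g) (fun e => hc (e ▸ rfl)) hx hy (by simpa using h)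
  · have := add_shift_eq_neg (f := f) (g := g) hx hy (by simpa [neg_add, -neg_add_rev] using h)
    exact ⟨⟨0, this.1⟩, 0, this.2⟩
  · have := add_shift_eq_neg (f := g) (g := f) hy hx (by simpa [neg_add, -neg_add_rev] using h.symm)
    exact ⟨⟨0, this.2⟩, 0, this.1⟩
  · refine add_shift_eq (f := f) (g := g) (fun e => hc (e ▸ rfl)) hx hy (neg_injective ?_)
    simpa only [Units.val_neg, Units.val_one, neg_smul, one_smul] using h

/-! ### Dilation of the unit cells -/

/-- Prepend a digit to a finitely supported expansion. -/
def digitCons (i : Fin 3) (f : ℕ →₀ Fin 3) : ℕ →₀ Fin 3 :=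
  Finsupp.ofSupportFinite (fun n => Nat.casesOn n i f) <| by
    refine ((f.support.finite_toSet.image Nat.succ).insert 0).subset fun n hn => ?_
    cases n with
    | zero => exact Set.mem_insert _ _
    | succ n => exact Or.inr ⟨n, by simpa using hn, rfl⟩

@[simp] theorem digitCons_zero (i : Fin 3) (f : ℕ →₀ Fin 3) : digitCons i f 0 = i := rfl
@[simp] theorem digitCons_succ (i : Fin 3) (f : ℕ →₀ Fin 3) (n : ℕ) :
    digitCons i f (n + 1) = f n := rfl

/-- The cells of side `1/2` correspond to the unit cells. -/
def consEquiv : TileIndex × Fin 3 ≃ TileIndex where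
  toFun p := (p.1.1, digitCons p.2 p.1.2)
  invFun c := ((c.1, c.2.comapDomain (· + 1) (add_left_injective 1).injOn), c.2 0)
  left_inv p := by
    refine Prod.ext (Prod.ext rfl ?_) rfl
    ext n; simp
  right_inv c := by
    refine Prod.ext rfl ?_
    ext n : 1
    cases n <;> simp

theorem shift_digitCons (i : Fin 3) (f : ℕ →₀ Fin 3) :
    shift (digitCons i f) = corner i + (2 : ℝ) • shift f := by
  obtain ⟨k, hk⟩ : ∃ k, f.support ⊆ Finset.range k := f.support.exists_nat_subset_range
  have hk' : (digitCons i f).support ⊆ Finset.range (k + 1) := by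
    intro n hn
    cases n with
    | zero => simp
    | succ n =>
      have : n ∈ f.support := by simpa using hn
      simpa using hk this
  rw [shift_eq_range hk', shift_eq_range hk, Finset.sum_range_succ', Finset.smul_sum, add_comm]
  simp [pow_succ', smul_smul]

/-- Doubling turns the first letter of a word into the lowest digit of the position. Statements
about small cells are thereby reduced to unit cells, and all scaling laws start here. -/
theorem two_smul_tile (c : TileIndex) (i : Fin 3) (x : Plane) :
    (2 : ℝ) • tile c (F i x) = tile (consEquiv (c, i)) x := by
  simp only [tile_eq, consEquiv, Equiv.coe_fn_mk, shift_digitCons, F]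
  rw [smul_comm, smul_add, smul_smul]
  norm_num [add_assoc]

/-- Two cells of the same size meet at most in common corners. -/
theorem tile_Fword_eq {c c' : TileIndex} {w w' : List (Fin 3)} (hw : w.length = w'.length)
    {x y : Plane} (hx : x ∈ Triangle) (hy : y ∈ Triangle)
    (h : tile c (Fword w x) = tile c' (Fword w' y)) :
    (c = c' ∧ w = w') ∨ ((∃ j, x = corner j) ∧ ∃ j, y = corner j) := by
  induction w generalizing c c' w' with
  | nil =>
    obtain rfl : w' = [] := List.length_eq_zero_iff.1 hw.symm
    by_cases hc : c = c'
    · exact Or.inl ⟨hc, rfl⟩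
    · exact Or.inr (tile_eq_tile hc hx hy h)
  | cons i v ih =>
    obtain _ | ⟨i', v'⟩ := w'
    · simp at hw
    · have h2 := congrArg ((2 : ℝ) • ·) h
      simp only [Fword, Function.comp, two_smul_tile] at h2
      rcases ih (by simpa using hw) h2 with ⟨e1, rfl⟩ | e
      · obtain ⟨rfl, rfl⟩ := Prod.ext_iff.1 (consEquiv.injective e1)
        exact Or.inl ⟨rfl, rfl⟩
      · exact Or.inr e

theorem tile_injective (c : TileIndex) : Function.Injective (tile c) := by
  intro x y h
  rw [tile_eq, tile_eq] at h
  rcases Int.units_eq_one_or c.1 with hc | hc <;> simpa [hc] using h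

theorem Fword_injective (w : List (Fin 3)) : Function.Injective (Fword w) := by
  induction w with
  | nil => exact Function.injective_id
  | cons i w ih => exact (F_injective i).comp ih

theorem dist_tile (c : TileIndex) (x y : Plane) : dist (tile c x) (tile c y) = dist x y := by
  rw [tile_eq, tile_eq]
  rcases Int.units_eq_one_or c.1 with hc | hc <;> simp [hc, -neg_add_rev]

theorem continuous_tile (c : TileIndex) : Continuous (tile c) :=
  (Isometry.of_dist_eq (dist_tile c)).continuous

/-! ### The cells cover the infinite gasket -/

theorem locallyFinite_tile : LocallyFinite fun c => tile c '' Triangle := by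
  intro x
  refine ⟨{y | |latA y| < |latA x| + 1} ∩ {y | |latB y| < |latB x| + 1}, inter_mem
    ((isOpen_lt continuous_latA.abs continuous_const).mem_nhds (by simp))
    ((isOpen_lt continuous_latB.abs continuous_const).mem_nhds (by simp)), ?_⟩
  have hinj : Function.Injective fun c : TileIndex => (c.1, shiftA c.2, shiftB c.2) := by
    rintro ⟨s, f⟩ ⟨t, g⟩ h
    simp only [Prod.mk.injEq] at h
    rw [h.1, shiftAB_injective h.2.1 h.2.2]
  refine Set.Finite.subset (Set.Finite.preimage hinj.injOn
    ((Set.finite_univ (α := ℤˣ)).prod ((Set.finite_Iio (⌈|latA x| + 1⌉₊)).prod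
      (Set.finite_Iio (⌈|latB x| + 1⌉₊))))) ?_
  rintro ⟨s, f⟩ ⟨_, ⟨z, ⟨h1, h2, -⟩, rfl⟩, ha, hb⟩
  simp only [Set.mem_ofPred_eq, tile_eq, latA_zsmul, latB_zsmul, latA_add, latB_add, latA_shift,
    latB_shift] at ha hb
  have hs : |((s : ℤ) : ℝ)| = 1 := by rcases Int.units_eq_one_or s with rfl | rfl <;> simp
  rw [abs_mul, hs, one_mul, abs_of_nonneg (by positivity)] at ha hb
  refine ⟨Set.mem_univ _, Nat.lt_ceil.2 ?_, Nat.lt_ceil.2 ?_⟩ <;> simp only <;> linarith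

theorem tile_gasket_subset (c : TileIndex) (w : List (Fin 3)) {x : Plane} (hx : x ∈ Gasket) :
    tile c (Fword w x) ∈ InfGasket := by
  have hcl : IsClosed InfGasket := isClosed_closure
  rw [← hcl.closure_eq]
  refine map_mem_closure (f := tile c ∘ Fword w)
    ((continuous_tile c).comp (continuous_Fword w)) hx fun y hy => ?_
  obtain ⟨m, hm⟩ := Set.mem_iUnion.1 hy
  obtain ⟨v, -, i, rfl⟩ := exists_Fword_of_mem_V hm
  simpa [Fword_append] using tile_vertex_mem c (w ++ v) i

theorem exists_two_pow_smul_tile (k : ℕ) (c : TileIndex) (w : List (Fin 3)) (hk : k ≤ w.length)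
    (x : Plane) : ∃ c' w', (2 : ℝ) ^ k • tile c (Fword w x) = tile c' (Fword w' x) := by
  induction k generalizing c w with
  | zero => exact ⟨c, w, by simp⟩
  | succ k ih =>
    obtain _ | ⟨i, v⟩ := w
    · simp at hk
    · obtain ⟨c', w', h⟩ := ih (consEquiv (c, i)) v (by simpa using hk)
      exact ⟨c', w', by rw [pow_succ, mul_smul, Fword, Function.comp, two_smul_tile, h]⟩

/-- Each vertex of the dense set lies in a unit cell, since its dilation can be absorbed letter by
letter into the digits. Local finiteness makes the union of the unit cells closed, so the closure
adds nothing. -/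
theorem exists_tile_eq {x : Plane} (hx : x ∈ InfGasket) : ∃ c, ∃ y ∈ Gasket, tile c y = x := by
  have hlf : LocallyFinite fun c => tile c '' Gasket :=
    locallyFinite_tile.subset fun c => Set.image_mono gasket_subset_triangle
  have hcl : IsClosed (⋃ c, tile c '' Gasket) :=
    hlf.isClosed_iUnion fun c => (isCompact_gasket.image (continuous_tile c)).isClosed
  have hV : ∀ (s : ℤˣ) (m k : ℕ) (z : Plane), z ∈ V (m + k) →
      (2 : ℝ) ^ k • ((s : ℤ) • z) ∈ ⋃ c, tile c '' Gasket := by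
    intro s m k z hz
    obtain ⟨w, hw, i, rfl⟩ := exists_Fword_of_mem_V hz
    obtain ⟨c', w', h⟩ := exists_two_pow_smul_tile k (s, 0) w (by omega) (corner i)
    refine Set.mem_iUnion.2 ⟨c', Fword w' (corner i), Fword_mem_gasket _ (corner_mem_gasket i), ?_⟩
    rw [← h, tile_eq]
    simp [shift]
  have hsub : InfGasket ⊆ ⋃ c, tile c '' Gasket := by
    refine closure_minimal (Set.iUnion_subset fun m => Set.iUnion_subset fun k => ?_) hcl
    rintro _ ⟨z, hz | hz, rfl⟩
    · simpa using hV 1 m k z hz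
    · simpa using hV (-1) m k (-z) hz
  simpa using hsub hx

theorem mem_cell {c : TileIndex} {w : List (Fin 3)} {x : InfGasket} :
    x ∈ cell c w ↔ ∃ y ∈ Gasket, tile c (Fword w y) = x := Iff.rfl

theorem exists_mem_cell (x : InfGasket) (n : ℕ) : ∃ c w, w.length = n ∧ x ∈ cell c w := by
  obtain ⟨c, y, hy, h⟩ := exists_tile_eq x.2
  obtain ⟨w, hw, z, hz, rfl⟩ := exists_Fword_eq n hy
  exact ⟨c, w, hw, z, hz, h⟩

theorem exists_mem_cell_append {c : TileIndex} {w : List (Fin 3)} {x : InfGasket}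
    (hx : x ∈ cell c w) (n : ℕ) : ∃ v, v.length = n ∧ x ∈ cell c (w ++ v) := by
  obtain ⟨y, hy, h⟩ := hx
  obtain ⟨v, hv, z, hz, rfl⟩ := exists_Fword_eq n hy
  exact ⟨v, hv, z, hz, by simpa only [Fword_append] using h⟩

theorem cell_append_subset (c : TileIndex) (w v : List (Fin 3)) : cell c (w ++ v) ⊆ cell c w := by
  rintro x ⟨y, hy, h⟩
  exact ⟨Fword v y, Fword_mem_gasket v hy, by rw [← h]; simp only [Fword_append]⟩

theorem vertex_mem_cell (c : TileIndex) (w : List (Fin 3)) (i : Fin 3) :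
    vertex c w i ∈ cell c w := ⟨_, corner_mem_gasket i, rfl⟩

theorem vertex_append_self (c : TileIndex) (w : List (Fin 3)) (n : ℕ) (i : Fin 3) :
    vertex c (w ++ List.replicate n i) i = vertex c w i := by
  apply Subtype.ext
  simp [vertex, Fword_append, Fword_replicate_corner]

theorem isClosed_cell (c : TileIndex) (w : List (Fin 3)) : IsClosed (cell c w) :=
  ((isCompact_gasket.image ((continuous_tile c).comp (continuous_Fword w))).isClosed).preimage
    continuous_subtype_val

theorem isCompact_cell (c : TileIndex) (w : List (Fin 3)) : IsCompact (cell c w) :=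
  IsClosed.isClosedEmbedding_subtypeVal (isClosed_closure : IsClosed InfGasket) |>.isCompact_preimage
    (isCompact_gasket.image ((continuous_tile c).comp (continuous_Fword w)))

theorem ediam_cell_le (c : TileIndex) (w : List (Fin 3)) :
    Metric.ediam (cell c w) ≤ ENNReal.ofReal (2 * (1 / 2) ^ w.length) := by
  refine Metric.ediam_le fun x hx y hy => ?_
  obtain ⟨x', hx', hx⟩ := hx
  obtain ⟨y', hy', hy⟩ := hy
  simp only at hx hy
  rw [Subtype.edist_eq, ← hx, ← hy, edist_dist, dist_tile, dist_Fword]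
  refine ENNReal.ofReal_le_ofReal ?_
  have h1 := norm_le_one_of_mem_triangle (gasket_subset_triangle hx')
  have h2 := norm_le_one_of_mem_triangle (gasket_subset_triangle hy')
  have h3 : dist x' y' ≤ 2 := by rw [dist_eq_norm]; linarith [norm_sub_le x' y']
  rw [mul_comm]
  gcongr

theorem eq_vertex_of_mem_cells {c c' : TileIndex} {w w' : List (Fin 3)}
    (hw : w.length = w'.length) (hne : ¬ (c = c' ∧ w = w')) {x : InfGasket} (hx : x ∈ cell c w)
    (hx' : x ∈ cell c' w') : (∃ j, x = vertex c w j) ∧ ∃ j, x = vertex c' w' j := by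
  obtain ⟨y, hy, h⟩ := hx
  obtain ⟨y', hy', h'⟩ := hx'
  rcases tile_Fword_eq hw (gasket_subset_triangle hy) (gasket_subset_triangle hy') (h.trans h'.symm)
    with e | ⟨⟨j, rfl⟩, j', rfl⟩
  · exact absurd e hne
  · exact ⟨⟨j, Subtype.ext h.symm⟩, j', Subtype.ext h'.symm⟩

/-- By local finiteness the cells of level `n` that miss `x` stay away from a neighbourhood of `x`.
Nearby points thus share a cell with `x`, which is how `tent` is seen to be continuous. -/
theorem eventually_mem_cell (x : InfGasket) (n : ℕ) :
    ∀ᶠ y in 𝓝 x, ∀ c w, w.length = n → y ∈ cell c w → x ∈ cell c w := by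
  have hfin : {w : List (Fin 3) | w.length = n}.Finite := List.finite_length_eq _ n
  have h : ∀ w ∈ {w : List (Fin 3) | w.length = n},
      ∀ᶠ y in 𝓝 x, ∀ c, y ∈ cell c w → x ∈ cell c w := by
    intro w _
    have hlf : LocallyFinite fun c => cell c w :=
      (locallyFinite_tile.preimage_continuous continuous_subtype_val).subset fun c => by
        rintro x ⟨y, hy, h⟩
        exact ⟨_, gasket_subset_triangle (Fword_mem_gasket w hy), h⟩
    filter_upwards [hlf.iInter_compl_mem_nhds (fun c => isClosed_cell c w) x] with y hy c hyc
    by_contra hx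
    simp only [Set.mem_iInter] at hy
    exact hy c hx hyc
  filter_upwards [(Filter.eventually_all_finite hfin).2 h] with y hy c w hw
  exact hy w hw c

theorem finite_setOf_mem_cell (x : InfGasket) : {c | x ∈ cell c []}.Finite := by
  refine (locallyFinite_tile.point_finite (x : Plane)).subset fun c hc => ?_
  obtain ⟨y, hy, h⟩ := hc
  exact ⟨y, gasket_subset_triangle hy, h⟩

/-! ### Dilations of the infinite gasket -/

theorem cell_cons_iff {c : TileIndex} {i : Fin 3} {w : List (Fin 3)} {x y : InfGasket}
    (h : (y : Plane) = (2 : ℝ) • (x : Plane)) :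
    x ∈ cell c (i :: w) ↔ y ∈ cell (consEquiv (c, i)) w := by
  simp only [mem_cell, Fword, Function.comp, h, ← two_smul_tile]
  simp

theorem two_smul_mem {x : Plane} (hx : x ∈ InfGasket) : (2 : ℝ) • x ∈ InfGasket := by
  obtain ⟨c, y, hy, rfl⟩ := exists_tile_eq hx
  obtain ⟨i, z, hz, rfl⟩ := exists_F_eq hy
  rw [two_smul_tile]
  exact tile_gasket_subset _ [] hz

theorem two_inv_smul_mem {x : Plane} (hx : x ∈ InfGasket) : (2 : ℝ)⁻¹ • x ∈ InfGasket := by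
  obtain ⟨c, y, hy, rfl⟩ := exists_tile_eq hx
  obtain ⟨⟨c, i⟩, rfl⟩ := consEquiv.surjective c
  rw [← two_smul_tile, smul_smul, inv_mul_cancel₀ two_ne_zero, one_smul]
  exact tile_gasket_subset c [i] hy

theorem zpow_smul_mem (k : ℤ) {x : Plane} (hx : x ∈ InfGasket) : (2 : ℝ) ^ k • x ∈ InfGasket := by
  induction k using Int.induction_on generalizing x with
  | zero => simpa using hx
  | succ n ih =>
    rw [zpow_add_one₀ two_ne_zero, mul_smul]
    exact ih (two_smul_mem hx)
  | pred n ih =>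
    rw [zpow_sub_one₀ two_ne_zero, mul_smul]
    exact ih (two_inv_smul_mem hx)

/-- The dilation `x ↦ 2ᵏ x` of the infinite gasket. -/
def dil (k : ℤ) : C(InfGasket, InfGasket) where
  toFun x := ⟨(2 : ℝ) ^ k • (x : Plane), zpow_smul_mem k x.2⟩
  continuous_toFun := by fun_prop

theorem coe_dil (k : ℤ) (x : InfGasket) : (dil k x : Plane) = (2 : ℝ) ^ k • (x : Plane) := rfl

theorem dil_dil (j k : ℤ) (x : InfGasket) : dil j (dil k x) = dil (j + k) x := by
  apply Subtype.ext
  rw [coe_dil, coe_dil, coe_dil, zpow_add₀ two_ne_zero, mul_smul]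

theorem dil_zero (x : InfGasket) : dil 0 x = x := by
  apply Subtype.ext
  rw [coe_dil, zpow_zero, one_smul]

theorem coe_dil_one (x : InfGasket) : (dil 1 x : Plane) = (2 : ℝ) • (x : Plane) := by
  rw [coe_dil, zpow_one]

theorem dil_one_vertex (c : TileIndex) (i : Fin 3) (w : List (Fin 3)) (j : Fin 3) :
    dil 1 (vertex c (i :: w) j) = vertex (consEquiv (c, i)) w j := by
  apply Subtype.ext
  rw [coe_dil_one]
  exact two_smul_tile _ _ _

theorem preimage_dil_one_cell (c : TileIndex) (i : Fin 3) (w : List (Fin 3)) :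
    dil 1 ⁻¹' cell (consEquiv (c, i)) w = cell c (i :: w) :=
  Set.ext fun x => (cell_cons_iff (coe_dil_one x)).symm

theorem preimage_dil_neg_one_cell (c : TileIndex) (i : Fin 3) (w : List (Fin 3)) :
    dil (-1) ⁻¹' cell c (i :: w) = cell (consEquiv (c, i)) w := by
  rw [← preimage_dil_one_cell]
  ext x
  simp [dil_dil, dil_zero]

theorem preimage_dil_neg_one_cell_nil (c : TileIndex) :
    dil (-1) ⁻¹' cell c [] = ⋃ i, cell (consEquiv (c, i)) [] := by
  simp only [← preimage_dil_neg_one_cell, ← Set.preimage_iUnion]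
  congr 1
  ext x
  rw [Set.mem_iUnion]
  refine ⟨fun h => ?_, fun ⟨i, h⟩ => cell_append_subset c [] [i] h⟩
  obtain ⟨v, hv, h⟩ := exists_mem_cell_append h 1
  obtain ⟨i, rfl⟩ := List.length_eq_one_iff.1 hv
  exact ⟨i, h⟩

/-! ### Sums over words -/

theorem sum_ofFn_succ_last {M : Type*} [AddCommMonoid M] (n : ℕ) (G : List (Fin 3) → M) :
    ∑ w : Fin (n + 1) → Fin 3, G (List.ofFn w) =
      ∑ w : Fin n → Fin 3, ∑ i, G (List.ofFn w ++ [i]) := by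
  rw [← (Fin.snocEquiv fun _ => Fin 3).sum_comp, Fintype.sum_prod_type, Finset.sum_comm]
  refine Finset.sum_congr rfl fun w _ => Finset.sum_congr rfl fun i _ => ?_
  rw [List.ofFn_succ', List.concat_eq_append]
  simp [Fin.snocEquiv]

theorem sum_ofFn_succ_first {M : Type*} [AddCommMonoid M] (n : ℕ) (G : List (Fin 3) → M) :
    ∑ w : Fin (n + 1) → Fin 3, G (List.ofFn w) =
      ∑ i, ∑ w : Fin n → Fin 3, G (i :: List.ofFn w) := by
  rw [← (Fin.consEquiv fun _ => Fin 3).sum_comp, Fintype.sum_prod_type]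
  refine Finset.sum_congr rfl fun i _ => Finset.sum_congr rfl fun w _ => ?_
  rw [List.ofFn_succ]
  simp [Fin.consEquiv]

theorem exists_ofFn_eq {n : ℕ} {w : List (Fin 3)} (h : w.length = n) :
    ∃ v : Fin n → Fin 3, List.ofFn v = w := by
  subst h; exact ⟨w.get, List.ofFn_get w⟩

/-! ### Mass distributions on words -/

/-- A consistent distribution of masses on the words, of the same decay as the Kusuoka measure. -/
structure IsMass (wt : List (Fin 3) → ℝ≥0∞) : Prop where
  sum_eq : ∀ w, ∑ i, wt (w ++ [i]) = wt w
  le : ∀ w, wt w ≤ ENNReal.ofReal ((3 / 5) ^ w.length)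

theorem ofReal_inv_three_pow (n : ℕ) : (3 : ℝ≥0∞)⁻¹ ^ n = ENNReal.ofReal ((1 / 3) ^ n) := by
  rw [ENNReal.ofReal_pow (by norm_num), one_div, ENNReal.ofReal_inv_of_pos (by norm_num)]
  norm_num

theorem isMass_hausdorff : IsMass fun w => (3 : ℝ≥0∞)⁻¹ ^ w.length where
  sum_eq w := by
    simp only [List.length_append, List.length_singleton, pow_succ, Finset.sum_const,
      Finset.card_univ, Fintype.card_fin, nsmul_eq_mul]
    rw [mul_left_comm, Nat.cast_ofNat, ENNReal.mul_inv_cancel (by norm_num) (by norm_num), mul_one]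
  le w := by
    rw [ofReal_inv_three_pow]
    exact ENNReal.ofReal_le_ofReal (pow_le_pow_left₀ (by norm_num) (by norm_num) _)

theorem isMass_kusuoka : IsMass fun w => ENNReal.ofReal (kusuokaWeight w) where
  sum_eq w := by
    rw [← ENNReal.ofReal_sum_of_nonneg fun i _ => kusuokaWeight_nonneg _, sum_kusuokaWeight]
  le w := ENNReal.ofReal_le_ofReal (kusuokaWeight_le w)

theorem tendsto_ofReal_pow : Tendsto (fun n : ℕ => ENNReal.ofReal ((3 / 5 : ℝ) ^ n)) atTop (𝓝 0) := by
  have := tendsto_pow_atTop_nhds_zero_of_lt_one (r := (3 / 5 : ℝ)) (by norm_num) (by norm_num)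
  simpa using ENNReal.tendsto_ofReal this

theorem IsMass.sum_append {wt : List (Fin 3) → ℝ≥0∞} (hwt : IsMass wt) (w : List (Fin 3)) (n : ℕ) :
    ∑ v : Fin n → Fin 3, wt (w ++ List.ofFn v) = wt w := by
  induction n with
  | zero => simp
  | succ n ih =>
    rw [sum_ofFn_succ_last n fun v => wt (w ++ v), ← ih]
    refine Finset.sum_congr rfl fun v _ => ?_
    simpa only [List.append_assoc] using hwt.sum_eq (w ++ List.ofFn v)

theorem IsMass.ne_top {wt : List (Fin 3) → ℝ≥0∞} (hwt : IsMass wt) (w : List (Fin 3)) : wt w ≠ ∞ :=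
  ((hwt.le w).trans_lt ENNReal.ofReal_lt_top).ne

/-! ### Infinite words -/

/-- The first `n` letters of an infinite word. -/
def initWord (ω : ℕ → Fin 3) (n : ℕ) : List (Fin 3) := (List.range n).map ω

theorem initWord_succ (ω : ℕ → Fin 3) (n : ℕ) : initWord ω (n + 1) = initWord ω n ++ [ω n] := by
  simp [initWord, List.range_succ]

@[simp] theorem length_initWord (ω : ℕ → Fin 3) (n : ℕ) : (initWord ω n).length = n := by
  simp [initWord]

/-- The infinite words which start with `w`. -/
def cylinder (w : List (Fin 3)) : Set (ℕ → Fin 3) := {ω | initWord ω w.length = w}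

theorem exists_path {G : List (Fin 3) → Prop} (h0 : G []) (h : ∀ u, G u → ∃ i, G (u ++ [i])) :
    ∃ ω, ∀ n, G (initWord ω n) := by
  choose! f hf using h
  let u : ℕ → List (Fin 3) := fun n => Nat.rec [] (fun _ v => v ++ [f v]) n
  have hu : ∀ n, initWord (fun n => f (u n)) n = u n := by
    intro n
    induction n with
    | zero => rfl
    | succ n ih => rw [initWord_succ, ih]
  refine ⟨fun n => f (u n), fun n => ?_⟩
  rw [hu]
  induction n with
  | zero => exact h0
  | succ n ih => exact hf _ ih

/-- Let `S u` be the mass of the covering cylinders inside the cylinder of `u`. If `S u < wt u`, the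
same holds for some one-letter extension of `u`, so a deficit at the root propagates along an
infinite word. That word lies in some covering cylinder `v n`, where `wt (v n) ≤ S (v n)` is a
contradiction. -/
theorem IsMass.le_tsum_of_cover {wt : List (Fin 3) → ℝ≥0∞} (hwt : IsMass wt)
    (v : ℕ → List (Fin 3)) (hv : ∀ ω, ∃ n, ω ∈ cylinder (v n)) : wt [] ≤ ∑' n, wt (v n) := by
  classical
  by_contra! hlt
  let S : List (Fin 3) → ℝ≥0∞ := fun u => ∑' n, if u <+: v n then wt (v n) else 0
  have hS : ∀ u, ∑ i, S (u ++ [i]) ≤ S u := by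
    intro u
    simp only [S]
    rw [← Summable.tsum_finsetSum fun _ _ => ENNReal.summable]
    refine ENNReal.tsum_le_tsum fun n => ?_
    by_cases h : ∃ i, u ++ [i] <+: v n
    · obtain ⟨i, hi⟩ := h
      rw [Finset.sum_eq_single i, if_pos hi, if_pos ((List.prefix_append _ _).trans hi)]
      · intro j _ hj
        rw [if_neg]
        intro hj'
        have := (List.prefix_of_prefix_length_le hi hj' (by simp)).eq_of_length (by simp)
        simp at this
        exact hj this.symm
      · simp
    · push Not at h
      rw [Finset.sum_eq_zero fun i _ => if_neg (h i)]
      exact zero_le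
  obtain ⟨ω, hω⟩ := exists_path (G := fun u => S u < wt u) (by simpa [S] using hlt) <| by
    intro u hu
    by_contra! hcon
    refine absurd hu (not_lt.2 ?_)
    calc wt u = ∑ i, wt (u ++ [i]) := (hwt.sum_eq u).symm
      _ ≤ ∑ i, S (u ++ [i]) := Finset.sum_le_sum fun i _ => hcon i
      _ ≤ S u := hS u
  obtain ⟨n, hn⟩ := hv ω
  have h1 : initWord ω (v n).length = v n := hn
  have h2 := hω (v n).length
  rw [h1] at h2
  refine absurd h2 (not_lt.2 ?_)
  calc wt (v n) = if v n <+: v n then wt (v n) else 0 := by rw [if_pos List.prefix_rfl]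
    _ ≤ S (v n) := ENNReal.le_tsum (f := fun k => if v n <+: v k then wt (v k) else 0) n

/-- The outer measure on the infinite words generated by the masses of the cylinders. -/
def pathOuter {wt : List (Fin 3) → ℝ≥0∞} (hwt : IsMass wt) : OuterMeasure (ℕ → Fin 3) :=
  OuterMeasure.ofFunction (fun s => ⨅ (w : List (Fin 3)) (_ : s ⊆ cylinder w), wt w) <| by
    -- The empty set lies in arbitrarily long cylinders, whose masses tend to zero.
    refine le_antisymm (ge_of_tendsto' tendsto_ofReal_pow fun n => ?_) zero_le
    refine (iInf₂_le (List.replicate n 0) (Set.empty_subset _)).trans ?_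
    simpa using hwt.le (List.replicate n 0)

theorem pathOuter_le {wt : List (Fin 3) → ℝ≥0∞} (hwt : IsMass wt) {s : Set (ℕ → Fin 3)}
    {w : List (Fin 3)} (h : s ⊆ cylinder w) : pathOuter hwt s ≤ wt w :=
  (OuterMeasure.ofFunction_le s).trans (iInf₂_le w h)

theorem le_pathOuter_univ {wt : List (Fin 3) → ℝ≥0∞} (hwt : IsMass wt) :
    wt [] ≤ pathOuter hwt Set.univ := by
  rw [pathOuter, OuterMeasure.ofFunction_apply]
  refine le_iInf₂ fun t ht => ?_
  refine ENNReal.le_of_forall_pos_le_add fun ε hε hfin => ?_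
  obtain ⟨ε', hε', hsum⟩ := ENNReal.exists_pos_sum_of_countable (ENNReal.coe_pos.2 hε).ne' ℕ
  have : ∀ n, ∃ w, t n ⊆ cylinder w ∧
      wt w ≤ (⨅ (w : List (Fin 3)) (_ : t n ⊆ cylinder w), wt w) + ε' n := by
    intro n
    have hne : (⨅ (w : List (Fin 3)) (_ : t n ⊆ cylinder w), wt w) ≠ ∞ :=
      ne_top_of_le_ne_top hfin.ne
        (ENNReal.le_tsum (f := fun n => ⨅ (w : List (Fin 3)) (_ : t n ⊆ cylinder w), wt w) n)
    have hlt := ENNReal.lt_add_right hne (ENNReal.coe_pos.2 (hε' n)).ne'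
    obtain ⟨w, hw⟩ := iInf_lt_iff.1 hlt
    obtain ⟨hw1, hw2⟩ := iInf_lt_iff.1 hw
    exact ⟨w, hw1, hw2.le⟩
  choose v hv1 hv2 using this
  calc wt [] ≤ ∑' n, wt (v n) := hwt.le_tsum_of_cover v fun ω => by
        obtain ⟨n, hn⟩ := Set.mem_iUnion.1 (ht (Set.mem_univ ω))
        exact ⟨n, hv1 n hn⟩
    _ ≤ _ := ENNReal.tsum_le_tsum hv2
    _ ≤ _ := by rw [ENNReal.tsum_add]; gcongr

theorem exists_forall_mem_cell (c : TileIndex) (ω : ℕ → Fin 3) :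
    ∃ x, ∀ n, x ∈ cell c (initWord ω n) := by
  have := IsCompact.nonempty_iInter_of_sequence_nonempty_isCompact_isClosed
    (fun n => cell c (initWord ω n))
    (fun n => by rw [initWord_succ]; exact cell_append_subset _ _ _)
    (fun n => ⟨_, vertex_mem_cell c _ 0⟩) (isCompact_cell _ _) (fun n => isClosed_cell _ _)
  obtain ⟨x, hx⟩ := this
  exact ⟨x, Set.mem_iInter.1 hx⟩

/-- The point of the cell `c` which is coded by the infinite word `ω`. -/
def codePoint (c : TileIndex) (ω : ℕ → Fin 3) : InfGasket :=
  (exists_forall_mem_cell c ω).choose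

theorem codePoint_mem (c : TileIndex) (ω : ℕ → Fin 3) (n : ℕ) :
    codePoint c ω ∈ cell c (initWord ω n) :=
  (exists_forall_mem_cell c ω).choose_spec n

theorem Fword_eq_add (w : List (Fin 3)) (x : Plane) :
    Fword w x = Fword w 0 + ((2 : ℝ)⁻¹ ^ w.length) • x := by
  induction w with
  | nil => simp [Fword]
  | cons i w ih =>
    simp only [Fword, Function.comp, F, List.length_cons, pow_succ']
    rw [ih, mul_smul]
    simp only [smul_add]
    abel

theorem eq_of_vertex_eq {c : TileIndex} {w w' : List (Fin 3)} (hw : w.length = w'.length)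
    {j : Fin 3} (h : vertex c w j = vertex c w' j) : w = w' := by
  have h1 := tile_injective c (congrArg Subtype.val h)
  rw [Fword_eq_add w, Fword_eq_add w', hw, add_left_inj] at h1
  -- Cells of equal level in one tile that share the corner of the same index are equal as maps.
  -- They then also share a midpoint, which is not a corner, and this forces equal words.
  have h2 : tile c (Fword w (F 0 (corner 1))) = tile c (Fword w' (F 0 (corner 1))) := by
    rw [Fword_eq_add w, Fword_eq_add w', hw, h1]
  have hT := F_mem_triangle 0 (corner_mem_triangle 1)
  rcases tile_Fword_eq hw hT hT h2 with e | ⟨⟨k, hk⟩, -⟩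
  · exact e.2
  · obtain rfl := eq_of_F_eq_corner (corner_mem_triangle 1) hk
    have := corner_injective (F_injective 0 (hk.trans (F_corner_self 0).symm))
    simp at this

/-- At level `n` either all codes of `x` share one prefix, or `x` is a corner of each of its cells
and the index of that corner determines the prefix. In both cases at most three cylinders suffice.
-/
theorem pathOuter_preimage_point {wt : List (Fin 3) → ℝ≥0∞} (hwt : IsMass wt) (c : TileIndex)
    (x : InfGasket) : pathOuter hwt (codePoint c ⁻¹' {x}) = 0 := by
  have hlim : Tendsto (fun n : ℕ => 3 * ENNReal.ofReal ((3 / 5 : ℝ) ^ n)) atTop (𝓝 0) := by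
    simpa using ENNReal.Tendsto.const_mul tendsto_ofReal_pow (a := 3) (Or.inr (by norm_num))
  refine le_antisymm (ge_of_tendsto' hlim fun n => ?_) zero_le
  have hsub : ∀ s : Set (ℕ → Fin 3), (∀ ω ∈ s, ∀ ω' ∈ s, initWord ω n = initWord ω' n) →
      pathOuter hwt s ≤ ENNReal.ofReal ((3 / 5 : ℝ) ^ n) := by
    intro s hs
    rcases s.eq_empty_or_nonempty with rfl | ⟨ω, hω⟩
    · simp
    · have : s ⊆ cylinder (initWord ω n) := fun ω' hω' => by
        simpa [cylinder] using hs ω' hω' ω hω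
      exact (pathOuter_le hwt this).trans (by simpa using hwt.le (initWord ω n))
  by_cases hone : ∀ ω ∈ codePoint c ⁻¹' {x}, ∀ ω' ∈ codePoint c ⁻¹' {x},
      initWord ω n = initWord ω' n
  · refine (hsub _ hone).trans ?_
    calc _ = 1 * ENNReal.ofReal ((3 / 5 : ℝ) ^ n) := (one_mul _).symm
      _ ≤ _ := by gcongr; norm_num
  · have hmem : ∀ ω ∈ codePoint c ⁻¹' {x}, x ∈ cell c (initWord ω n) := by
      rintro ω rfl; exact codePoint_mem c ω n
    push Not at hone
    obtain ⟨ω₁, h₁, ω₂, h₂, hne⟩ := hone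
    have hcov : codePoint c ⁻¹' {x} ⊆ ⋃ j, {ω | x = vertex c (initWord ω n) j} := by
      intro ω hω
      refine Set.mem_iUnion.2 ?_
      by_cases h : initWord ω n = initWord ω₁ n
      · exact (eq_vertex_of_mem_cells (by simp) (fun e => hne (h.symm.trans e.2)) (hmem ω hω)
          (hmem ω₂ h₂)).1
      · exact (eq_vertex_of_mem_cells (by simp) (fun e => h e.2) (hmem ω hω) (hmem ω₁ h₁)).1
    calc pathOuter hwt (codePoint c ⁻¹' {x})
        ≤ pathOuter hwt (⋃ j, {ω | x = vertex c (initWord ω n) j}) := measure_mono hcov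
      _ ≤ ∑ j : Fin 3, pathOuter hwt {ω | x = vertex c (initWord ω n) j} :=
          measure_iUnion_fintype_le _ _
      _ ≤ ∑ j : Fin 3, ENNReal.ofReal ((3 / 5 : ℝ) ^ n) := by
          refine Finset.sum_le_sum fun j _ => hsub _ fun ω hω ω' hω' => ?_
          exact eq_of_vertex_eq (by simp) (hω.symm.trans hω')
      _ = _ := by simp

/-- A word coding a point of the cell either begins with `w` or codes one of its three corners, and
corners have null preimage. This also covers the case `c ≠ c'`. -/
theorem pathOuter_preimage_cell {wt : List (Fin 3) → ℝ≥0∞} (hwt : IsMass wt) (c c' : TileIndex)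
    (w : List (Fin 3)) : pathOuter hwt (codePoint c ⁻¹' cell c' w) ≤ wt w := by
  have hsub : codePoint c ⁻¹' cell c' w ⊆
      cylinder w ∪ ⋃ j, codePoint c ⁻¹' {vertex c' w j} := by
    intro ω hω
    by_cases h : c = c' ∧ initWord ω w.length = w
    · exact Or.inl h.2
    · exact Or.inr (Set.mem_iUnion.2 (eq_vertex_of_mem_cells (by simp) h
        (codePoint_mem c ω w.length) hω).2)
  refine (measure_mono hsub).trans ((measure_union_le _ _).trans ?_)
  rw [measure_iUnion_null fun j => pathOuter_preimage_point hwt c _, add_zero]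
  exact pathOuter_le hwt subset_rfl

/-! ### The measures generated by the masses of the cells -/

/-- The metric construction is the largest candidate compatible with the weights, already at the
scale `∞`. All lower bounds for `cellMeasure`, and the scaling of the Hausdorff measure, come from
this comparison. -/
theorem le_cellMeasure {wt : List (Fin 3) → ℝ≥0∞} (μ : OuterMeasure InfGasket)
    (h : ∀ c w, μ (cell c w) ≤ wt w) (s : Set InfGasket) : μ s ≤ cellMeasure wt s := by
  have h1 : μ ≤ OuterMeasure.mkMetric'.pre
      (fun s => ⨅ (c : TileIndex) (w : List (Fin 3)) (_ : s ⊆ cell c w), wt w) ∞ :=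
    OuterMeasure.mkMetric'.le_pre.2 fun s _ =>
      le_iInf fun c => le_iInf fun w => le_iInf fun hs => (measure_mono hs).trans (h c w)
  have h2 : μ ≤ OuterMeasure.mkMetric'
      (fun s => ⨅ (c : TileIndex) (w : List (Fin 3)) (_ : s ⊆ cell c w), wt w) :=
    h1.trans (le_iSup₂_of_le ∞ (by simp) le_rfl)
  exact (h2 s).trans (le_toMeasure_apply _ (OuterMeasure.mkMetric'_isMetric _).le_caratheodory _)

theorem IsMass.cellMeasure_cell_le {wt : List (Fin 3) → ℝ≥0∞} (hwt : IsMass wt) (c : TileIndex)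
    (w : List (Fin 3)) :
    cellMeasure wt (cell c w) ≤ wt w := by
  rw [cellMeasure, Measure.mkMetric', toMeasure_apply _ _ (isClosed_cell c w).measurableSet,
    OuterMeasure.mkMetric']
  simp only [OuterMeasure.iSup_apply]
  refine iSup₂_le fun r hr => ?_
  have hlim : Tendsto (fun n : ℕ => ENNReal.ofReal (2 * (1 / 2 : ℝ) ^ n)) atTop (𝓝 0) := by
    have := (tendsto_pow_atTop_nhds_zero_of_lt_one (r := (1 / 2 : ℝ)) (by norm_num)
      (by norm_num)).const_mul 2
    simpa using ENNReal.tendsto_ofReal this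
  obtain ⟨n, hn⟩ := (hlim.eventually_lt_const hr).exists
  have hcov : cell c w ⊆ ⋃ v : Fin n → Fin 3, cell c (w ++ List.ofFn v) := by
    intro x hx
    obtain ⟨v, hv, hxv⟩ := exists_mem_cell_append hx n
    obtain ⟨v, rfl⟩ := exists_ofFn_eq hv
    exact Set.mem_iUnion.2 ⟨v, hxv⟩
  refine (measure_mono hcov).trans ((measure_iUnion_fintype_le _ _).trans ?_)
  rw [← hwt.sum_append w n]
  refine Finset.sum_le_sum fun v _ => ?_
  refine (OuterMeasure.mkMetric'.pre_le ?_).trans 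
    (iInf_le_of_le c (iInf_le_of_le (w ++ List.ofFn v) (iInf_le _ subset_rfl)))
  refine (ediam_cell_le c _).trans (le_trans (ENNReal.ofReal_le_ofReal ?_) hn.le)
  rw [List.length_append, List.length_ofFn]
  gcongr 2 * ?_
  exact pow_le_pow_of_le_one (by norm_num) (by norm_num) (Nat.le_add_left _ _)

theorem IsMass.le_cellMeasure_cell_nil {wt : List (Fin 3) → ℝ≥0∞} (hwt : IsMass wt)
    (c : TileIndex) : wt [] ≤ cellMeasure wt (cell c []) := by
  refine le_trans ?_ (le_cellMeasure (OuterMeasure.map (codePoint c) (pathOuter hwt))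
    (fun c' w => ?_) _)
  · rw [OuterMeasure.map_apply]
    refine (le_pathOuter_univ hwt).trans (measure_mono fun ω _ => ?_)
    exact codePoint_mem c ω 0
  · rw [OuterMeasure.map_apply]
    exact pathOuter_preimage_cell hwt c c' w

/-- The upper bounds of all cells of level `w.length` in one tile add up to `wt []`, which is a
lower bound for the whole tile. Hence none of them can be strict. -/
theorem IsMass.cellMeasure_cell {wt : List (Fin 3) → ℝ≥0∞} (hwt : IsMass wt) (c : TileIndex)
    (w : List (Fin 3)) :
    cellMeasure wt (cell c w) = wt w := by
  classical
  refine le_antisymm (hwt.cellMeasure_cell_le c w) ?_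
  obtain ⟨v₀, hv₀⟩ := exists_ofFn_eq (n := w.length) (w := w) rfl
  have hcov : cell c [] ⊆ ⋃ v : Fin w.length → Fin 3, cell c (List.ofFn v) := by
    intro x hx
    obtain ⟨v, hv, hxv⟩ := exists_mem_cell_append hx w.length
    obtain ⟨v, rfl⟩ := exists_ofFn_eq hv
    exact Set.mem_iUnion.2 ⟨v, hxv⟩
  have h1 : wt [] ≤ ∑ v : Fin w.length → Fin 3, cellMeasure wt (cell c (List.ofFn v)) :=
    (hwt.le_cellMeasure_cell_nil c).trans
      ((measure_mono hcov).trans (measure_iUnion_fintype_le _ _))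
  have h2 : ∑ v : Fin w.length → Fin 3, wt (List.ofFn v) = wt [] := hwt.sum_append [] _
  rw [← h2, ← Finset.add_sum_erase _ _ (Finset.mem_univ v₀),
    ← Finset.add_sum_erase _ (fun v => cellMeasure wt (cell c (List.ofFn v)))
      (Finset.mem_univ v₀), hv₀] at h1
  have h3 : ∑ v ∈ Finset.univ.erase v₀, cellMeasure wt (cell c (List.ofFn v)) ≤
      ∑ v ∈ Finset.univ.erase v₀, wt (List.ofFn v) :=
    Finset.sum_le_sum fun v _ => hwt.cellMeasure_cell_le c _
  have h4 : ∑ v ∈ Finset.univ.erase v₀, wt (List.ofFn v) ≠ ∞ :=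
    ENNReal.sum_ne_top.2 fun v _ => hwt.ne_top _
  exact (ENNReal.add_le_add_iff_right h4).1 (h1.trans (by gcongr))

theorem IsMass.cellMeasure_singleton {wt : List (Fin 3) → ℝ≥0∞} (hwt : IsMass wt)
    (x : InfGasket) : cellMeasure wt {x} = 0 := by
  refine le_antisymm (ge_of_tendsto' tendsto_ofReal_pow fun n => ?_) zero_le
  obtain ⟨c, w, hw, hx⟩ := exists_mem_cell x n
  refine (measure_mono (Set.singleton_subset_iff.2 hx)).trans ?_
  rw [hwt.cellMeasure_cell, ← hw]
  exact hwt.le w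

theorem IsMass.nullSingletonClass {wt : List (Fin 3) → ℝ≥0∞} (hwt : IsMass wt) :
    NullSingletonClass (cellMeasure wt) := ⟨hwt.cellMeasure_singleton⟩

theorem finite_inter_cell {c c' : TileIndex} {w w' : List (Fin 3)} (hw : w.length = w'.length)
    (hne : ¬ (c = c' ∧ w = w')) : (cell c w ∩ cell c' w').Finite := by
  refine (Set.finite_range (vertex c w)).subset ?_
  rintro x ⟨h1, h2⟩
  obtain ⟨⟨j, hj⟩, -⟩ := eq_vertex_of_mem_cells hw hne h1 h2
  exact ⟨j, hj.symm⟩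

theorem dil_injective (k : ℤ) : Function.Injective (dil k) := by
  intro x y h
  have := congrArg (dil (-k)) h
  simpa [dil_dil, dil_zero] using this

theorem preimage_dil_dil (j k : ℤ) (s : Set InfGasket) :
    dil j ⁻¹' (dil k ⁻¹' s) = dil (k + j) ⁻¹' s := by
  ext x; simp [dil_dil]

theorem exists_preimage_dil_natCast_cell (n : ℕ) (c : TileIndex) (w : List (Fin 3)) :
    ∃ c' w', w'.length = w.length + n ∧ dil n ⁻¹' cell c w = cell c' w' := by
  induction n generalizing c w with
  | zero => exact ⟨c, w, rfl, by ext x; simp [dil_zero]⟩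
  | succ n ih =>
    obtain ⟨⟨c, i⟩, rfl⟩ := consEquiv.surjective c
    obtain ⟨c', w', hw, h⟩ := ih c (i :: w)
    refine ⟨c', w', by rw [hw, List.length_cons]; omega, ?_⟩
    rw [← h, ← preimage_dil_one_cell, preimage_dil_dil]
    push_cast
    rw [add_comm]

/-- A cell of side `2 ^ n` splits into `3 ^ n` unit cells with finite, hence null, intersections.
Above unit scale the mass is therefore exact for every weight. -/
theorem IsMass.cellMeasure_preimage_dil_neg {wt : List (Fin 3) → ℝ≥0∞} (hwt : IsMass wt) (n : ℕ)
    (c : TileIndex) : cellMeasure wt (dil (-n) ⁻¹' cell c []) = 3 ^ n * wt [] := by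
  have := hwt.nullSingletonClass
  induction n generalizing c with
  | zero =>
    rw [pow_zero, one_mul, ← hwt.cellMeasure_cell c]
    congr 1
    ext x; simp [dil_zero]
  | succ n ih =>
    have e : dil (-((n + 1 : ℕ) : ℤ)) ⁻¹' cell c [] =
        ⋃ i, dil (-n) ⁻¹' cell (consEquiv (c, i)) [] := by
      rw [← Set.preimage_iUnion, ← preimage_dil_neg_one_cell_nil, preimage_dil_dil]
      congr 3
      push_cast; ring
    rw [e, measure_iUnion₀ (μ := cellMeasure wt) ?_ fun i =>
      ((isClosed_cell _ _).preimage (dil _).continuous).measurableSet.nullMeasurableSet]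
    · simp [ih, tsum_fintype, pow_succ', mul_assoc]
    · intro i j hij
      refine Set.Finite.measure_zero ?_ _
      rw [← Set.preimage_inter]
      refine Set.Finite.preimage (dil_injective _).injOn (finite_inter_cell rfl fun e => hij ?_)
      simpa using consEquiv.injective e.1

theorem hausdorffHat_cell (c : TileIndex) (w : List (Fin 3)) :
    hausdorffHat (cell c w) = (3 : ℝ≥0∞)⁻¹ ^ w.length :=
  isMass_hausdorff.cellMeasure_cell c w

theorem kusuokaHat_cell (c : TileIndex) (w : List (Fin 3)) :
    kusuokaHat (cell c w) = ENNReal.ofReal (kusuokaWeight w) :=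
  isMass_kusuoka.cellMeasure_cell c w

theorem measurable_dil (k : ℤ) : Measurable (dil k) := (dil k).continuous.measurable

theorem map_dil_map_dil (j k : ℤ) (μ : Measure InfGasket) :
    (μ.map (dil k)).map (dil j) = μ.map (dil (j + k)) := by
  rw [Measure.map_map (measurable_dil j) (measurable_dil k)]
  congr 1
  funext x
  exact dil_dil j k x

/-- The suitably scaled images under `dil 1` and `dil (-1)` do not exceed the weights on cells, so
both lie below `hausdorffHat` by `le_cellMeasure`. These two inequalities are inverse to each other.
-/
theorem map_dil_one_hausdorffHat : hausdorffHat.map (dil 1) = (3 : ℝ≥0∞)⁻¹ • hausdorffHat := by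
  have h33 : (3 : ℝ≥0∞) * 3⁻¹ = 1 := ENNReal.mul_inv_cancel (by norm_num) (by norm_num)
  have h1 : ∀ s, ((3 : ℝ≥0∞) • OuterMeasure.map (dil 1) hausdorffHat.toOuterMeasure) s ≤
      hausdorffHat s := by
    refine le_cellMeasure _ fun c w => ?_
    obtain ⟨⟨c, i⟩, rfl⟩ := consEquiv.surjective c
    rw [smul_apply, OuterMeasure.map_apply, preimage_dil_one_cell,
      Measure.coe_toOuterMeasure, hausdorffHat_cell, List.length_cons, pow_succ, smul_eq_mul,
      mul_left_comm, h33, mul_one]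
  have h2 : ∀ s, ((3 : ℝ≥0∞)⁻¹ • OuterMeasure.map (dil (-1)) hausdorffHat.toOuterMeasure) s ≤
      hausdorffHat s := by
    refine le_cellMeasure _ fun c w => ?_
    rw [smul_apply, OuterMeasure.map_apply, Measure.coe_toOuterMeasure, smul_eq_mul]
    cases w with
    | nil =>
      rw [preimage_dil_neg_one_cell_nil, mul_comm, ← div_eq_mul_inv]
      refine ENNReal.div_le_of_le_mul ((measure_iUnion_fintype_le _ _).trans ?_)
      simp [hausdorffHat_cell]
    | cons i w =>
      rw [preimage_dil_neg_one_cell, hausdorffHat_cell, List.length_cons, pow_succ']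
  ext s hs
  rw [Measure.map_apply (measurable_dil 1) hs, Measure.smul_apply, smul_eq_mul]
  have h1 := h1 s
  have h2 := h2 (dil 1 ⁻¹' s)
  rw [smul_apply, OuterMeasure.map_apply, Measure.coe_toOuterMeasure,
    smul_eq_mul] at h1 h2
  rw [preimage_dil_dil] at h2
  have e : dil (1 + -1) ⁻¹' s = s := by ext x; simp [dil_zero]
  rw [e] at h2
  refine le_antisymm ?_ h2
  calc _ = 3⁻¹ * (3 * hausdorffHat (dil 1 ⁻¹' s)) := by
        rw [← mul_assoc, mul_comm (3⁻¹ : ℝ≥0∞), h33, one_mul]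
    _ ≤ _ := by gcongr

theorem map_dil_neg_one_hausdorffHat : hausdorffHat.map (dil (-1)) = (3 : ℝ≥0∞) • hausdorffHat := by
  have h := congrArg (fun μ => (3 : ℝ≥0∞) • μ.map (dil (-1))) map_dil_one_hausdorffHat
  simp only [map_dil_map_dil, Measure.map_smul, smul_smul] at h
  rw [ENNReal.mul_inv_cancel (by norm_num) (by norm_num), one_smul] at h
  rw [← h]
  congr 1
  have : (dil (-1 + 1) : InfGasket → InfGasket) = id := by funext x; simp [dil_zero]
  rw [this, Measure.map_id]

theorem map_dil_hausdorffHat (k : ℤ) :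
    hausdorffHat.map (dil k) = (3 : ℝ≥0∞) ^ (-k : ℝ) • hausdorffHat := by
  have h3 : (3 : ℝ≥0∞) ≠ 0 := by norm_num
  have h3' : (3 : ℝ≥0∞) ≠ ∞ := by norm_num
  induction k using Int.induction_on with
  | zero =>
    have : (dil 0 : InfGasket → InfGasket) = id := by funext x; simp [dil_zero]
    simp [this]
  | succ n ih =>
    rw [add_comm, ← map_dil_map_dil, ih, Measure.map_smul, map_dil_one_hausdorffHat, smul_smul,
      ← ENNReal.rpow_neg_one, ← ENNReal.rpow_add _ _ h3 h3']
    congr 2; push_cast; ring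
  | pred n ih =>
    rw [sub_eq_add_neg, add_comm, ← map_dil_map_dil, ih, Measure.map_smul,
      map_dil_neg_one_hausdorffHat, smul_smul]
    nth_rw 2 [← ENNReal.rpow_one 3]
    rw [← ENNReal.rpow_add _ _ h3 h3']
    congr 2; push_cast; ring

/-! ### Energies of cells -/

/-- The values of `u` at the corners of a cell. -/
def cellValues (u : C(InfGasket, ℝ)) (c : TileIndex) (w : List (Fin 3)) (i : Fin 3) : ℝ :=
  u (vertex c w i)

/-- The contribution of a unit cell to the energy at level `m`. -/
def tileEnergy (m : ℕ) (u : C(InfGasket, ℝ)) (c : TileIndex) : ℝ≥0∞ :=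
  ∑ w : Fin m → Fin 3, ENNReal.ofReal (3 * (5 / 3) ^ m * quad (cellValues u c (List.ofFn w)))

theorem energyLevel_eq (m : ℕ) (u : C(InfGasket, ℝ)) :
    energyLevel m u = ∑' c, tileEnergy m u c := by
  refine tsum_congr fun c => Finset.sum_congr rfl fun w _ => ?_
  have h : ∀ x y : ℝ, 0 ≤ 2⁻¹ * (5 / 3 : ℝ) ^ m * (x - y) ^ 2 := fun x y => by positivity
  simp only [Fin.sum_univ_three]
  repeat rw [← ENNReal.ofReal_add (by positivity) (by positivity)]
  congr 1
  rw [quad_eq]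
  simp only [cellValues]
  ring

theorem vertex_append_swap (c : TileIndex) (w : List (Fin 3)) (i j : Fin 3) :
    vertex c (w ++ [i]) j = vertex c (w ++ [j]) i := by
  apply Subtype.ext
  simp only [vertex, Fword_append]
  simp [Fword, F, add_comm]

theorem cellValues_append_self (u : C(InfGasket, ℝ)) (c : TileIndex) (w : List (Fin 3))
    (i : Fin 3) : cellValues u c (w ++ [i]) i = cellValues u c w i :=
  congrArg u (vertex_append_self c w 1 i)

theorem quad_cellValues_le (u : C(InfGasket, ℝ)) (c : TileIndex) (w : List (Fin 3)) :
    quad (cellValues u c w) ≤ 5 / 3 * ∑ i, quad (cellValues u c (w ++ [i])) := by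
  have h0 := cellValues_append_self u c w 0
  have h1 := cellValues_append_self u c w 1
  have h2 := cellValues_append_self u c w 2
  have s (i j : Fin 3) : cellValues u c (w ++ [i]) j = cellValues u c (w ++ [j]) i :=
    congrArg u (vertex_append_swap c w i j)
  simp only [Fin.sum_univ_three, quad_eq, h0, h1, h2, s 1 0, s 2 0, s 2 1]
  generalize cellValues u c w 0 = x0
  generalize cellValues u c w 1 = x1
  generalize cellValues u c w 2 = x2
  generalize cellValues u c (w ++ [0]) 1 = a
  generalize cellValues u c (w ++ [0]) 2 = d
  generalize cellValues u c (w ++ [1]) 2 = b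
  -- The midpoint values are written as harmonic values plus deviations. The energy then has no
  -- mixed terms, and what the deviations contribute is a sum of squares.
  obtain ⟨a', ha⟩ : ∃ a', a' = a - (2 * x0 + 2 * x1 + x2) / 5 := ⟨_, rfl⟩
  obtain ⟨b', hb⟩ : ∃ b', b' = b - (x0 + 2 * x1 + 2 * x2) / 5 := ⟨_, rfl⟩
  obtain ⟨d', hd⟩ : ∃ d', d' = d - (2 * x0 + x1 + 2 * x2) / 5 := ⟨_, rfl⟩
  obtain rfl : a = a' + (2 * x0 + 2 * x1 + x2) / 5 := by linarith
  obtain rfl : b = b' + (x0 + 2 * x1 + 2 * x2) / 5 := by linarith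
  obtain rfl : d = d' + (2 * x0 + x1 + 2 * x2) / 5 := by linarith
  linarith [sq_nonneg a', sq_nonneg b', sq_nonneg d', sq_nonneg (a' - b'), sq_nonneg (b' - d'),
    sq_nonneg (a' - d')]

theorem tileEnergy_mono (u : C(InfGasket, ℝ)) (c : TileIndex) :
    Monotone fun m => tileEnergy m u c := by
  refine monotone_nat_of_le_succ fun m => ?_
  simp only [tileEnergy]
  rw [sum_ofFn_succ_last m fun w => ENNReal.ofReal (3 * (5 / 3) ^ (m + 1) * quad (cellValues u c w))]
  refine Finset.sum_le_sum fun w _ => ?_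
  rw [← ENNReal.ofReal_sum_of_nonneg fun i _ => mul_nonneg (by positivity) (quad_nonneg _)]
  refine ENNReal.ofReal_le_ofReal ?_
  rw [← Finset.mul_sum, pow_succ]
  have h := quad_cellValues_le u c (List.ofFn w)
  have : (0 : ℝ) < 3 * (5 / 3) ^ m := by positivity
  nlinarith

theorem energyLevel_mono (u : C(InfGasket, ℝ)) : Monotone fun m => energyLevel m u := by
  intro m n h
  simp only [energyLevel_eq]
  exact ENNReal.tsum_le_tsum fun c => tileEnergy_mono u c h

/-- The energy of `u` on a unit cell. -/
def localEnergy (u : C(InfGasket, ℝ)) (c : TileIndex) : ℝ≥0∞ := ⨆ m, tileEnergy m u c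

theorem tsum_localEnergy_le (u : C(InfGasket, ℝ)) : ∑' c, localEnergy u c ≤ energy u := by
  rw [ENNReal.tsum_eq_iSup_sum]
  refine iSup_le fun s => ?_
  simp only [localEnergy]
  rw [ENNReal.finsetSum_iSup_of_monotone fun c => tileEnergy_mono u c]
  refine iSup_mono fun m => ?_
  rw [energyLevel_eq]
  exact ENNReal.sum_le_tsum s

/-! ### Oscillation on a unit cell -/

theorem abs_cellValues_sub_le {u : C(InfGasket, ℝ)} {c : TileIndex} (hu : localEnergy u c ≠ ∞)
    (w : List (Fin 3)) (i j : Fin 3) :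
    |cellValues u c w i - cellValues u c w j| ≤
      (4 / 5) ^ w.length * Real.sqrt (localEnergy u c).toReal := by
  have h1 : 3 * (5 / 3) ^ w.length * quad (cellValues u c w) ≤ (localEnergy u c).toReal := by
    rw [← ENNReal.ofReal_le_iff_le_toReal hu]
    refine le_trans ?_ (le_iSup (fun m => tileEnergy m u c) w.length)
    obtain ⟨v, hv⟩ := exists_ofFn_eq (n := w.length) (w := w) rfl
    have := Finset.single_le_sum (f := fun v : Fin w.length → Fin 3 =>
      ENNReal.ofReal (3 * (5 / 3) ^ w.length * quad (cellValues u c (List.ofFn v))))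
      (fun _ _ => zero_le) (Finset.mem_univ v)
    simp only [hv] at this
    exact this
  have h2 : (cellValues u c w i - cellValues u c w j) ^ 2 ≤ 3 * quad (cellValues u c w) := by
    rw [quad_eq]
    fin_cases i <;> fin_cases j <;> simp <;>
    nlinarith [sq_nonneg (cellValues u c w 0 - cellValues u c w 1),
      sq_nonneg (cellValues u c w 1 - cellValues u c w 2),
      sq_nonneg (cellValues u c w 0 - cellValues u c w 2)]
  have hE : 0 ≤ (localEnergy u c).toReal := ENNReal.toReal_nonneg
  refine abs_le_of_sq_le_sq ?_ (by positivity)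
  rw [mul_pow, Real.sq_sqrt hE, ← pow_mul, mul_comm w.length, pow_mul]
  -- The energy bound decays like `√(3/5)` per level; `4/5` is a rational upper bound for this root.
  have h3 : (1 : ℝ) ≤ ((4 / 5) ^ 2) ^ w.length * (5 / 3) ^ w.length := by
    rw [← mul_pow]; exact one_le_pow₀ (by norm_num)
  have h4 : (0 : ℝ) < ((4 / 5) ^ 2) ^ w.length := by positivity
  calc _ ≤ 3 * quad (cellValues u c w) := h2
    _ ≤ ((4 / 5) ^ 2) ^ w.length * (5 / 3) ^ w.length * (3 * quad (cellValues u c w)) :=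
        le_mul_of_one_le_left (by linarith [quad_nonneg (cellValues u c w)]) h3
    _ = ((4 / 5) ^ 2) ^ w.length * (3 * (5 / 3) ^ w.length * quad (cellValues u c w)) := by ring
    _ ≤ _ := by gcongr

/-- Each new letter `k` keeps the value at corner `k`, so the differences telescope. The factor is
the partial sum of the powers of `4/5` up to the length of `w`. -/
theorem abs_cellValues_sub_nil_le {u : C(InfGasket, ℝ)} {c : TileIndex}
    (hu : localEnergy u c ≠ ∞) (w : List (Fin 3)) (i : Fin 3) :
    |cellValues u c w i - cellValues u c [] 0| ≤
      (5 - 4 * (4 / 5) ^ w.length) * Real.sqrt (localEnergy u c).toReal := by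
  induction w using List.reverseRecOn generalizing i with
  | nil => simpa using (abs_cellValues_sub_le hu [] i 0).trans (by norm_num)
  | append_singleton w k ih =>
    have h1 := abs_cellValues_sub_le hu (w ++ [k]) i k
    rw [cellValues_append_self, List.length_append, List.length_singleton] at h1
    have h2 := ih k
    have h3 := abs_sub_le (cellValues u c (w ++ [k]) i) (cellValues u c w k) (cellValues u c [] 0)
    rw [List.length_append, List.length_singleton]
    rw [pow_succ] at h1 ⊢
    linarith

theorem tendsto_vertex {x : InfGasket} {c : TileIndex} {w : ℕ → List (Fin 3)}
    (hw : ∀ n, (w n).length = n) (hx : ∀ n, x ∈ cell c (w n)) (i : Fin 3) :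
    Tendsto (fun n => vertex c (w n) i) atTop (𝓝 x) := by
  refine tendsto_iff_edist_tendsto_0.2 ?_
  have hlim : Tendsto (fun n : ℕ => ENNReal.ofReal (2 * (1 / 2 : ℝ) ^ n)) atTop (𝓝 0) := by
    have := (tendsto_pow_atTop_nhds_zero_of_lt_one (r := (1 / 2 : ℝ)) (by norm_num)
      (by norm_num)).const_mul 2
    simpa using ENNReal.tendsto_ofReal this
  refine tendsto_of_tendsto_of_tendsto_of_le_of_le tendsto_const_nhds hlim (fun _ => zero_le)
    fun n => ?_
  refine (Metric.edist_le_ediam_of_mem (vertex_mem_cell c (w n) i) (hx n)).trans ?_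
  simpa [hw] using ediam_cell_le c (w n)

theorem abs_sub_vertex_le {u : C(InfGasket, ℝ)} {c : TileIndex} (hu : localEnergy u c ≠ ∞)
    {x : InfGasket} (hx : x ∈ cell c []) :
    |u x - cellValues u c [] 0| ≤ 5 * Real.sqrt (localEnergy u c).toReal := by
  choose w hw hxw using fun n => exists_mem_cell_append hx n
  have h1 : Tendsto (fun n => |u (vertex c (w n) 0) - cellValues u c [] 0|) atTop
      (𝓝 |u x - cellValues u c [] 0|) :=
    (((u.continuous.tendsto x).comp (tendsto_vertex hw hxw 0)).sub_const _).abs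
  refine le_of_tendsto' h1 fun n => (abs_cellValues_sub_nil_le hu (w n) 0).trans ?_
  gcongr
  have : (0 : ℝ) < (4 / 5) ^ (w n).length := by positivity
  linarith

theorem enorm_le_add_localEnergy (u : C(InfGasket, ℝ)) {c : TileIndex} {x y : InfGasket}
    (hx : x ∈ cell c []) (hy : y ∈ cell c []) :
    ‖u x‖ₑ ≤ ‖u y‖ₑ + 10 * localEnergy u c ^ (1 / 2 : ℝ) := by
  by_cases hu : localEnergy u c = ∞
  · simp [hu]
  have h1 := abs_sub_vertex_le hu hx
  have h2 := abs_sub_vertex_le hu hy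
  have h3 := abs_sub_le (u x) (cellValues u c [] 0) (u y)
  rw [abs_sub_comm (cellValues u c [] 0) (u y)] at h3
  have h4 : |u x| ≤ |u y| + 10 * Real.sqrt (localEnergy u c).toReal := by
    have := abs_sub_abs_le_abs_sub (u x) (u y)
    linarith
  rw [Real.enorm_eq_ofReal_abs, Real.enorm_eq_ofReal_abs]
  refine (ENNReal.ofReal_le_ofReal h4).trans ?_
  rw [ENNReal.ofReal_add (by positivity) (by positivity), ENNReal.ofReal_mul (by norm_num),
    Real.sqrt_eq_rpow, ← ENNReal.ofReal_rpow_of_nonneg ENNReal.toReal_nonneg (by norm_num),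
    ENNReal.ofReal_toReal hu]
  norm_num

/-! ### Scaling -/

theorem cellValues_comp_dil_one (u : C(InfGasket, ℝ)) (c : TileIndex) (i : Fin 3)
    (w : List (Fin 3)) :
    cellValues (u.comp (dil 1)) c (i :: w) = cellValues u (consEquiv (c, i)) w := by
  funext j
  exact congrArg u (dil_one_vertex c i w j)

/-- Cells of level `m + 1` for the dilated function are cells of level `m` for `u`, matched by
`consEquiv`; only one factor `5/3` of the normalization remains. -/
theorem energyLevel_comp_dil_one (m : ℕ) (u : C(InfGasket, ℝ)) :
    energyLevel (m + 1) (u.comp (dil 1)) = ENNReal.ofReal (5 / 3) * energyLevel m u := by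
  simp only [energyLevel_eq, tileEnergy]
  have h (G : TileIndex → ℝ≥0∞) : ∑' c, G c = ∑' c, ∑ i, G (consEquiv (c, i)) := by
    rw [← consEquiv.tsum_eq, ENNReal.tsum_prod']
    simp only [tsum_fintype]
  rw [h (fun c => ∑ w : Fin m → Fin 3, _), ← ENNReal.tsum_mul_left]
  refine tsum_congr fun c => ?_
  rw [sum_ofFn_succ_first m fun w =>
    ENNReal.ofReal (3 * (5 / 3) ^ (m + 1) * quad (cellValues (u.comp (dil 1)) c w)), Finset.mul_sum]
  refine Finset.sum_congr rfl fun i _ => ?_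
  rw [Finset.mul_sum]
  refine Finset.sum_congr rfl fun w _ => ?_
  rw [cellValues_comp_dil_one, ← ENNReal.ofReal_mul (by norm_num), pow_succ]
  congr 1
  ring

theorem energy_comp_dil_one (u : C(InfGasket, ℝ)) :
    energy (u.comp (dil 1)) = ENNReal.ofReal (5 / 3) * energy u := by
  rw [energy, ← (energyLevel_mono _).iSup_nat_add 1]
  simp only [energyLevel_comp_dil_one]
  rw [← ENNReal.mul_iSup, energy]

theorem one_div_deltaS : 1 / deltaS = Real.log 5 / Real.log 3 - 1 := by
  rw [deltaS, one_div, inv_inv]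

theorem log_three_pos : 0 < Real.log 3 := Real.log_pos (by norm_num)

theorem one_div_deltaS_pos : 0 < 1 / deltaS := by
  rw [one_div_deltaS, sub_pos, one_lt_div log_three_pos]
  exact Real.log_lt_log (by norm_num) (by norm_num)

theorem one_div_deltaS_lt_one : 1 / deltaS < 1 := by
  rw [one_div_deltaS, sub_lt_iff_lt_add, div_lt_iff₀ log_three_pos]
  have : Real.log 5 < Real.log (3 ^ 2) := Real.log_lt_log (by norm_num) (by norm_num)
  rw [Real.log_pow] at this
  push_cast at this
  linarith

theorem deltaS_pos : 0 < deltaS := one_div_pos.1 one_div_deltaS_pos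

theorem one_lt_deltaS : 1 < deltaS := by
  have h := one_div_deltaS_lt_one
  rwa [div_lt_one deltaS_pos] at h

/-- This identity is the role of `deltaS`: all scaling factors become powers of 3, and comparing
them becomes linear arithmetic in the exponents. -/
theorem three_rpow_one_div_deltaS : (3 : ℝ) ^ (1 / deltaS) = 5 / 3 := by
  rw [one_div_deltaS, Real.rpow_sub (by norm_num), Real.rpow_one,
    Real.rpow_def_of_pos (by norm_num), mul_div_cancel₀ _ log_three_pos.ne',
    Real.exp_log (by norm_num)]

theorem ofReal_three_rpow (s : ℝ) : ENNReal.ofReal ((3 : ℝ) ^ s) = (3 : ℝ≥0∞) ^ s := by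
  rw [← ENNReal.ofReal_rpow_of_pos (by norm_num)]
  norm_num

theorem three_rpow_add (s t : ℝ) : (3 : ℝ≥0∞) ^ (s + t) = 3 ^ s * 3 ^ t :=
  ENNReal.rpow_add s t (by norm_num) (by norm_num)

theorem three_rpow_ne_zero (s : ℝ) : (3 : ℝ≥0∞) ^ s ≠ 0 :=
  (ENNReal.rpow_pos (by norm_num) (by norm_num)).ne'

theorem three_rpow_ne_top (s : ℝ) : (3 : ℝ≥0∞) ^ s ≠ ∞ :=
  ENNReal.rpow_ne_top_of_ne_zero (by norm_num) (by norm_num)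

theorem comp_dil_comp_dil (u : C(InfGasket, ℝ)) (j k : ℤ) :
    (u.comp (dil j)).comp (dil k) = u.comp (dil (j + k)) := by
  ext x; simp [dil_dil]

theorem comp_dil_zero (u : C(InfGasket, ℝ)) : u.comp (dil 0) = u := by
  ext x; simp [dil_zero]

theorem energy_comp_dil (u : C(InfGasket, ℝ)) (k : ℤ) :
    energy (u.comp (dil k)) = 3 ^ (k / deltaS) * energy u := by
  have h : ∀ k : ℤ, energy (u.comp (dil (k + 1))) = 3 ^ (1 / deltaS) * energy (u.comp (dil k)) := by
    intro k
    rw [← comp_dil_comp_dil, energy_comp_dil_one, ← three_rpow_one_div_deltaS, ofReal_three_rpow]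
  induction k using Int.induction_on with
  | zero => simp [comp_dil_zero]
  | succ n ih =>
    rw [h, ih, ← mul_assoc, ← three_rpow_add]
    congr 2; push_cast; ring
  | pred n ih =>
    have h' := h (-n - 1)
    rw [sub_add_cancel, ih] at h'
    refine (ENNReal.mul_right_inj (three_rpow_ne_zero (1 / deltaS)) (three_rpow_ne_top _)).1 ?_
    rw [← h', ← mul_assoc, ← three_rpow_add]
    congr 2; push_cast; ring

theorem eLpNorm_comp_dil (u : C(InfGasket, ℝ)) (q : ℝ≥0∞) (σ : Measure InfGasket) (k : ℤ) :
    eLpNorm (u.comp (dil k)) q σ = eLpNorm u q (σ.map (dil k)) := by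
  rw [eLpNorm_map_measure u.continuous.aestronglyMeasurable (measurable_dil k).aemeasurable]
  rfl

theorem eLpNorm_comp_dil_hausdorffHat (u : C(InfGasket, ℝ)) (p : ℝ≥0∞) (k : ℤ) :
    eLpNorm (u.comp (dil k)) p hausdorffHat =
      3 ^ (-k * p⁻¹.toReal) * eLpNorm u p hausdorffHat := by
  rw [eLpNorm_comp_dil, map_dil_hausdorffHat,
    eLpNorm_smul_measure_of_ne_zero (three_rpow_ne_zero _), smul_eq_mul, one_div,
    ENNReal.rpow_mul]

theorem comp_dil_mem_domain {u : C(InfGasket, ℝ)} (hu : u ∈ domain) (k : ℤ) :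
    u.comp (dil k) ∈ domain := by
  refine ⟨?_, (u.comp (dil k)).continuous.aestronglyMeasurable, ?_⟩
  · rw [energy_comp_dil]
    exact ENNReal.mul_lt_top (three_rpow_ne_top _).lt_top hu.1
  · rw [eLpNorm_comp_dil_hausdorffHat]
    exact ENNReal.mul_lt_top (three_rpow_ne_top _).lt_top hu.2.2

/-! ### The Sobolev inequality on all scales -/

theorem iUnion_cell_nil : ⋃ c, cell c [] = Set.univ := by
  refine Set.eq_univ_of_forall fun x => ?_
  obtain ⟨c, w, hw, hx⟩ := exists_mem_cell x 0
  obtain rfl := List.length_eq_zero_iff.1 hw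
  exact Set.mem_iUnion.2 ⟨c, hx⟩

/-- The embedding of `ℓ^r` into `ℓ^q` with constant one: every term is at most `X`, so the surplus
power `X ^ (q - r)` can be pulled out. -/
theorem tsum_rpow_le {ι : Type*} {f : ι → ℝ≥0∞} {X : ℝ≥0∞} {r q : ℝ} (hr : 0 < r) (hrq : r ≤ q)
    (h : ∑' i, f i ^ r ≤ X ^ r) : ∑' i, f i ^ q ≤ X ^ q := by
  have hle : ∀ i, f i ≤ X := fun i =>
    (ENNReal.rpow_le_rpow_iff hr).1 ((ENNReal.le_tsum i).trans h)
  have e : ∀ x : ℝ≥0∞, x ^ q = x ^ r * x ^ (q - r) := fun x => by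
    rw [← ENNReal.rpow_add_of_nonneg _ _ hr.le (by linarith), add_sub_cancel]
  calc ∑' i, f i ^ q ≤ ∑' i, f i ^ r * X ^ (q - r) := ENNReal.tsum_le_tsum fun i => by
        rw [e]; gcongr; exact hle i
    _ = (∑' i, f i ^ r) * X ^ (q - r) := ENNReal.tsum_mul_right
    _ ≤ X ^ q := by rw [e X]; gcongr

theorem tsum_eLpNorm_restrict_rpow_le {p : ℝ≥0∞} (hp0 : p ≠ 0) (hp : p ≠ ∞)
    (u : C(InfGasket, ℝ)) :
    ∑' c, eLpNorm u p (hausdorffHat.restrict (cell c [])) ^ p.toReal ≤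
      eLpNorm u p hausdorffHat ^ p.toReal := by
  have hpos : 0 < p.toReal := ENNReal.toReal_pos hp0 hp
  have e : ∀ σ : Measure InfGasket, eLpNorm u p σ ^ p.toReal = ∫⁻ x, ‖u x‖ₑ ^ p.toReal ∂σ := by
    intro σ
    rw [eLpNorm_eq_lintegral_rpow_enorm_toReal hp0 hp, ← ENNReal.rpow_mul,
      one_div_mul_cancel hpos.ne', ENNReal.rpow_one]
  have := isMass_hausdorff.nullSingletonClass
  simp only [e]
  rw [← lintegral_iUnion₀ (fun c => (isClosed_cell c []).measurableSet.nullMeasurableSet),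
    iUnion_cell_nil, Measure.restrict_univ]
  intro c c' hc
  exact (finite_inter_cell rfl fun h => hc h.1).measure_zero (cellMeasure _)

theorem enorm_le_eLpNorm_restrict_add {p : ℝ≥0∞} (hp0 : p ≠ 0) (u : C(InfGasket, ℝ))
    {c : TileIndex} {x : InfGasket} (hx : x ∈ cell c []) :
    ‖u x‖ₑ ≤ eLpNorm u p (hausdorffHat.restrict (cell c [])) +
      10 * localEnergy u c ^ (1 / 2 : ℝ) := by
  -- At a minimum point of `|u|` the value is bounded by the `L^p` norm with constant one, because
  -- the cell has mass one.
  obtain ⟨y, hy, hmin⟩ := (isCompact_cell c []).exists_isMinOn ⟨x, hx⟩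
    (u.continuous.norm.continuousOn)
  have huniv : hausdorffHat.restrict (cell c []) Set.univ = 1 := by
    rw [Measure.restrict_apply_univ, hausdorffHat_cell]; simp
  refine (enorm_le_add_localEnergy u hx hy).trans ?_
  gcongr
  have hne : hausdorffHat.restrict (cell c []) ≠ 0 := fun h => by simp [h] at huniv
  calc ‖u y‖ₑ = eLpNorm (fun _ => u y) p (hausdorffHat.restrict (cell c [])) := by
        rw [eLpNorm_const _ hp0 hne, huniv]; simp
    _ ≤ _ := eLpNorm_mono_ae <| by
        filter_upwards [ae_restrict_mem (isClosed_cell c []).measurableSet] with z hz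
        exact hmin hz

theorem eLpNorm_le_unit_scale {σ : Measure InfGasket} {M : ℝ≥0∞} (hσ : ∀ c, σ (cell c []) ≤ M)
    {p q : ℝ≥0∞} (hp : 1 ≤ p) (hpq : p ≤ q) (hq : 2 ≤ q) (u : C(InfGasket, ℝ)) :
    eLpNorm u q σ ≤ 20 * M ^ q⁻¹.toReal *
      (eLpNorm u p hausdorffHat + energy u ^ (1 / 2 : ℝ)) := by
  have hp0 : p ≠ 0 := (zero_lt_one.trans_le hp).ne'
  set A := eLpNorm u p hausdorffHat
  set X := energy u ^ (1 / 2 : ℝ)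
  have hX : ∀ x : ℝ≥0∞, (x ^ (1 / 2 : ℝ)) ^ (2 : ℝ) = x := fun x => by
    rw [← ENNReal.rpow_mul]; norm_num
  have hbound : 2 * (A + 10 * X) ≤ 20 * (A + X) := by
    calc 2 * (A + 10 * X) = 2 * A + 20 * X := by rw [mul_add, ← mul_assoc]; norm_num
      _ ≤ 20 * A + 20 * X := by gcongr; norm_num
      _ = _ := (mul_add _ _ _).symm
  rcases eq_or_ne q ∞ with rfl | hq'
  · have h1 : eLpNorm u ∞ σ ≤ A + 10 * X := by
      rw [eLpNorm_exponent_top]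
      refine eLpNormEssSup_le_of_ae_enorm_bound (Eventually.of_forall fun x => ?_)
      obtain ⟨c, hx⟩ := Set.mem_iUnion.1 (iUnion_cell_nil ▸ Set.mem_univ x : x ∈ ⋃ c, cell c [])
      refine (enorm_le_eLpNorm_restrict_add hp0 u hx).trans ?_
      gcongr
      · exact eLpNorm_mono_measure _ Measure.restrict_le_self
      · exact ENNReal.rpow_le_rpow ((ENNReal.le_tsum c).trans (tsum_localEnergy_le u)) (by norm_num)
    calc _ ≤ 1 * (A + 10 * X) := by rwa [one_mul]
      _ ≤ 2 * (A + 10 * X) := by gcongr; norm_num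
      _ ≤ _ := hbound
      _ = _ := by simp
  · have hp' : p ≠ ∞ := ne_top_of_le_ne_top hq' hpq
    have hq0 : q ≠ 0 := (hp0.bot_lt.trans_le hpq).ne'
    have hpr : 0 < p.toReal := ENNReal.toReal_pos hp0 hp'
    have hpqr : p.toReal ≤ q.toReal := ENNReal.toReal_mono hq' hpq
    have hqr : 2 ≤ q.toReal := by simpa using ENNReal.toReal_mono hq' hq
    have hq1 : 0 < q.toReal := by linarith
    set a : TileIndex → ℝ≥0∞ := fun c => eLpNorm u p (hausdorffHat.restrict (cell c []))
    set e : TileIndex → ℝ≥0∞ := fun c => localEnergy u c ^ (1 / 2 : ℝ)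
    -- Here `p ≤ q` is needed for the local norms, and below `2 ≤ q` for the roots of the local
    -- energies.
    have ha : ∑' c, a c ^ q.toReal ≤ A ^ q.toReal :=
      tsum_rpow_le hpr hpqr (tsum_eLpNorm_restrict_rpow_le hp0 hp' u)
    have he : ∑' c, e c ^ q.toReal ≤ X ^ q.toReal := by
      refine tsum_rpow_le two_pos hqr ?_
      simp only [e, X, hX]
      exact tsum_localEnergy_le u
    have h1 : ∫⁻ x, ‖u x‖ₑ ^ q.toReal ∂σ ≤ M * (2 * (A + 10 * X)) ^ q.toReal := by
      calc ∫⁻ x, ‖u x‖ₑ ^ q.toReal ∂σ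
          = ∫⁻ x in ⋃ c, cell c [], ‖u x‖ₑ ^ q.toReal ∂σ := by
            rw [iUnion_cell_nil, Measure.restrict_univ]
        _ ≤ ∑' c, ∫⁻ x in cell c [], ‖u x‖ₑ ^ q.toReal ∂σ := lintegral_iUnion_le _ _
        _ ≤ ∑' c, M * (2 ^ q.toReal * (a c ^ q.toReal + 10 ^ q.toReal * e c ^ q.toReal)) := by
            refine ENNReal.tsum_le_tsum fun c => ?_
            calc ∫⁻ x in cell c [], ‖u x‖ₑ ^ q.toReal ∂σ
                ≤ ∫⁻ x in cell c [], (a c + 10 * e c) ^ q.toReal ∂σ :=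
                  setLIntegral_mono' (isClosed_cell c []).measurableSet fun x hx =>
                    ENNReal.rpow_le_rpow (enorm_le_eLpNorm_restrict_add hp0 u hx) hq1.le
              _ = (a c + 10 * e c) ^ q.toReal * σ (cell c []) := by rw [setLIntegral_const]
              _ ≤ (2 ^ q.toReal * (a c ^ q.toReal + (10 * e c) ^ q.toReal)) * M := by
                  gcongr
                  · refine (ENNReal.rpow_add_le_mul_rpow_add_rpow _ _ (by linarith)).trans ?_
                    gcongr
                    · norm_num
                    · linarith
                  · exact hσ c
              _ = _ := by rw [mul_comm, ENNReal.mul_rpow_of_nonneg _ _ hq1.le]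
        _ = M * (2 ^ q.toReal * (∑' c, a c ^ q.toReal + 10 ^ q.toReal * ∑' c, e c ^ q.toReal)) := by
            rw [ENNReal.tsum_mul_left, ENNReal.tsum_mul_left, ENNReal.tsum_add,
              ENNReal.tsum_mul_left]
        _ ≤ M * (2 ^ q.toReal * (A ^ q.toReal + 10 ^ q.toReal * X ^ q.toReal)) := by gcongr
        _ ≤ _ := by
            rw [ENNReal.mul_rpow_of_nonneg _ _ hq1.le, ← ENNReal.mul_rpow_of_nonneg _ _ hq1.le]
            gcongr
            exact ENNReal.add_rpow_le_rpow_add _ _ (by linarith)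
    rw [eLpNorm_eq_lintegral_rpow_enorm_toReal hq0 hq']
    calc (∫⁻ x, ‖u x‖ₑ ^ q.toReal ∂σ) ^ (1 / q.toReal)
        ≤ (M * (2 * (A + 10 * X)) ^ q.toReal) ^ (1 / q.toReal) := by gcongr
      _ = M ^ q⁻¹.toReal * (2 * (A + 10 * X)) := by
          rw [ENNReal.mul_rpow_of_nonneg _ _ (by positivity), ← ENNReal.rpow_mul,
            mul_one_div_cancel hq1.ne', ENNReal.rpow_one, ENNReal.toReal_inv, one_div]
      _ ≤ M ^ q⁻¹.toReal * (20 * (A + X)) := by gcongr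
      _ = _ := by rw [← mul_assoc, mul_comm (M ^ q⁻¹.toReal)]

theorem eLpNorm_le_scale {σ : Measure InfGasket} {M : ℝ≥0∞} (k : ℤ)
    (hσ : ∀ c, σ (dil k ⁻¹' cell c []) ≤ M)
    {p q : ℝ≥0∞} (hp : 1 ≤ p) (hpq : p ≤ q) (hq : 2 ≤ q) (u : C(InfGasket, ℝ)) :
    eLpNorm u q σ ≤ 20 * M ^ q⁻¹.toReal * (3 ^ (k * p⁻¹.toReal) * eLpNorm u p hausdorffHat +
      3 ^ (-k / (2 * deltaS)) * energy u ^ (1 / 2 : ℝ)) := by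
  have hσ' : ∀ c, σ.map (dil k) (cell c []) ≤ M := fun c => by
    rw [Measure.map_apply (measurable_dil k) (isClosed_cell c []).measurableSet]; exact hσ c
  have h := eLpNorm_le_unit_scale hσ' hp hpq hq (u.comp (dil (-k)))
  rw [← eLpNorm_comp_dil, comp_dil_comp_dil, neg_add_cancel, comp_dil_zero,
    eLpNorm_comp_dil_hausdorffHat, energy_comp_dil, ENNReal.mul_rpow_of_nonneg _ _ (by norm_num),
    ← ENNReal.rpow_mul] at h
  refine h.trans_eq ?_
  push_cast
  rw [neg_neg, show -(k : ℝ) / deltaS * (1 / 2) = -k / (2 * deltaS) by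
    rw [div_mul_div_comm, mul_one, mul_comm 2]]

theorem toReal_inv_le_one {p : ℝ≥0∞} (hp : 1 ≤ p) : p⁻¹.toReal ≤ 1 := by
  have : p⁻¹ ≤ 1 := ENNReal.inv_le_one.2 hp
  simpa using ENNReal.toReal_mono ENNReal.one_ne_top this

theorem exists_eq_three_rpow {z : ℝ≥0∞} (h0 : z ≠ 0) (h1 : z ≠ ∞) : ∃ s : ℝ, z = 3 ^ s := by
  have hz : 0 < z.toReal := ENNReal.toReal_pos h0 h1
  refine ⟨Real.log z.toReal / Real.log 3, ?_⟩
  rw [← ofReal_three_rpow, Real.rpow_def_of_pos (by norm_num),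
    mul_div_cancel₀ _ log_three_pos.ne', Real.exp_log hz, ENNReal.ofReal_toReal h1]

theorem three_rpow_mono {s t : ℝ} (h : s ≤ t) : (3 : ℝ≥0∞) ^ s ≤ 3 ^ t :=
  ENNReal.rpow_le_rpow_of_exponent_le (by norm_num) h

theorem one_div_two_deltaS_pos : 0 < 1 / (2 * deltaS) := by
  have := deltaS_pos; positivity

theorem one_div_two_deltaS_le_one : 1 / (2 * deltaS) ≤ 1 := by
  have := one_lt_deltaS
  rw [div_le_one (by linarith)]; linarith

/-- Optimization over the scale. -/
theorem exists_le_of_forall_scale {E A N : ℝ≥0∞} (hE0 : E ≠ 0) (hE : E ≠ ∞) (hA0 : A ≠ 0)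
    (hA : A ≠ ∞) {α : ℝ} (hα : 0 ≤ α) {ρ : ℤ → ℝ} (hρ0 : ∀ k, 0 ≤ ρ k) (hρ : ∀ k, ρ k ≤ 1)
    (h : ∀ k : ℤ, N ≤ 20 * 3 ^ (-k * ρ k) *
      (3 ^ (k * α) * A + 3 ^ (-k / (2 * deltaS)) * E ^ (1 / 2 : ℝ))) :
    ∃ k, N ≤ 240 * (E ^ ((α - ρ k) / (α + 1 / (2 * deltaS)) / 2) *
      A ^ (1 - (α - ρ k) / (α + 1 / (2 * deltaS)))) := by
  obtain ⟨x, rfl⟩ := exists_eq_three_rpow hE0 hE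
  obtain ⟨y, rfl⟩ := exists_eq_three_rpow hA0 hA
  have hδ := one_div_two_deltaS_pos
  have hδ1 := one_div_two_deltaS_le_one
  have hk2 : ∀ k : ℤ, -(k : ℝ) / (2 * deltaS) = -(k * (1 / (2 * deltaS))) := fun k => by ring
  simp only [hk2] at h
  set β := 1 / (2 * deltaS)
  have hD : 0 < α + β := by linarith
  -- At the real scale `t` the two summands are equal. Rounding down to an integer costs at most a
  -- factor 3 in the prefactor and 3 in the energy term, so the constant is `20 * 3 * (1 + 3) =
  -- 240`. The rate `ρ` may depend on the scale, as the Kusuoka measure requires.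
  obtain ⟨t, ht⟩ : ∃ t, t = (x / 2 - y) / (α + β) := ⟨_, rfl⟩
  have hx : x / 2 = y + t * α + t * β := by
    have : t * (α + β) = x / 2 - y := by rw [ht]; field_simp
    linarith
  refine ⟨⌊t⌋, (h ⌊t⌋).trans ?_⟩
  have hk := Int.floor_le t
  have hk' := Int.lt_floor_add_one t
  set r := ρ ⌊t⌋
  have hr0 : 0 ≤ r := hρ0 _
  have hr1 : r ≤ 1 := hρ _
  generalize (⌊t⌋ : ℝ) = κ at hk hk'
  have e1 : (3 : ℝ≥0∞) ^ (-κ * r) ≤ 3 ^ (1 - t * r) := by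
    apply three_rpow_mono; nlinarith
  have e2 : (3 : ℝ≥0∞) ^ (κ * α) * 3 ^ y ≤ 3 ^ (y + t * α) := by
    rw [← three_rpow_add]; apply three_rpow_mono; nlinarith
  have e3 : (3 : ℝ≥0∞) ^ (-(κ * β)) * (3 ^ x) ^ (1 / 2 : ℝ) ≤ 3 ^ (1 + (y + t * α)) := by
    rw [← ENNReal.rpow_mul, ← three_rpow_add]; apply three_rpow_mono; nlinarith
  have e4 : (α - r) / (α + β) * (x / 2 - y) = t * (α - r) := by rw [ht]; ring
  have e5 : ((3 : ℝ≥0∞) ^ x) ^ ((α - r) / (α + β) / 2) * (3 ^ y) ^ (1 - (α - r) / (α + β)) =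
      3 ^ (-(t * r)) * 3 ^ (y + t * α) := by
    rw [← ENNReal.rpow_mul, ← ENNReal.rpow_mul, ← three_rpow_add, ← three_rpow_add]
    congr 1
    linear_combination e4
  rw [e5]
  calc 20 * (3 : ℝ≥0∞) ^ (-κ * r) *
        (3 ^ (κ * α) * 3 ^ y + 3 ^ (-(κ * β)) * (3 ^ x) ^ (1 / 2 : ℝ))
      ≤ 20 * 3 ^ (1 - t * r) * (3 ^ (y + t * α) + 3 ^ (1 + (y + t * α))) := by gcongr
    _ = 240 * (3 ^ (-(t * r)) * 3 ^ (y + t * α)) := by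
        rw [sub_eq_add_neg, three_rpow_add, three_rpow_add 1, ENNReal.rpow_one]
        ring

theorem eLpNorm_top_dirac (u : C(InfGasket, ℝ)) (x : InfGasket) :
    ‖u x‖ₑ ≤ eLpNorm u ∞ (Measure.dirac x) := by
  have := enorm_ae_le_eLpNormEssSup u (Measure.dirac x)
  rw [ae_dirac_eq] at this
  rw [eLpNorm_exponent_top]
  exact this

/-- A Dirac measure has mass at most one on cells of every size, so the general estimate with `q =
∞` becomes a bound at every point rather than almost everywhere. -/
theorem enorm_le_scale {p : ℝ≥0∞} (hp : 1 ≤ p) (u : C(InfGasket, ℝ)) (x : InfGasket) (k : ℤ) :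
    ‖u x‖ₑ ≤ 20 * (3 ^ (k * p⁻¹.toReal) * eLpNorm u p hausdorffHat +
      3 ^ (-k / (2 * deltaS)) * energy u ^ (1 / 2 : ℝ)) := by
  refine (eLpNorm_top_dirac u x).trans ?_
  simpa using eLpNorm_le_scale (σ := Measure.dirac x) (M := 1) k (fun c => prob_le_one) hp le_top
    le_top u

theorem tendsto_three_rpow_mul_neg {s : ℝ} (hs : 0 < s) {B : ℝ≥0∞} (hB : B ≠ ∞) :
    Tendsto (fun n : ℕ => (3 : ℝ≥0∞) ^ (-(n * s)) * B) atTop (𝓝 0) := by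
  have h1 : Tendsto (fun n : ℕ => ((3 : ℝ≥0∞) ^ (-s)) ^ n) atTop (𝓝 0) := by
    refine ENNReal.tendsto_pow_atTop_nhds_zero_of_lt_one ?_
    exact ENNReal.rpow_lt_one_of_one_lt_of_neg (by norm_num) (by linarith)
  have h2 := ENNReal.Tendsto.mul_const h1 (Or.inr hB)
  rw [zero_mul] at h2
  refine h2.congr fun n => ?_
  rw [← ENNReal.rpow_natCast, ← ENNReal.rpow_mul]
  congr 2; ring

/-- Without the energy term, the bound at scale `-n` is a multiple of `3 ^ (-n / 2)` and tends to
zero. Excluding this degenerate case lets the energy be written as a power of 3. -/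
theorem eq_zero_of_energy_eq_zero {u : C(InfGasket, ℝ)} (hu : u ∈ domain) (h : energy u = 0) :
    u = 0 := by
  ext x
  refine enorm_eq_zero.1 (le_antisymm (ge_of_tendsto'
    (tendsto_three_rpow_mul_neg (s := 1 / 2) (by norm_num)
      (ENNReal.mul_ne_top (a := 20) (by norm_num) hu.2.2.ne)) fun n => ?_) zero_le)
  refine (enorm_le_scale (p := 2) (by norm_num) u x (-n)).trans_eq ?_
  rw [h]
  simp only [one_div, inv_pos, Nat.ofNat_pos, ENNReal.zero_rpow_of_pos, mul_zero, add_zero]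
  rw [mul_left_comm]
  congr 2
  simp

/-- Here the scales tend to `+∞` instead: only the energy term is left, and its factor decays. -/
theorem eq_zero_of_eLpNorm_eq_zero {u : C(InfGasket, ℝ)} (hu : u ∈ domain) {p : ℝ≥0∞}
    (hp : 1 ≤ p) (h : eLpNorm u p hausdorffHat = 0) : u = 0 := by
  ext x
  have hE : 20 * energy u ^ (1 / 2 : ℝ) ≠ ∞ :=
    ENNReal.mul_ne_top (by norm_num) (ENNReal.rpow_ne_top_of_nonneg (by norm_num) hu.1.ne)
  refine enorm_eq_zero.1 (le_antisymm (ge_of_tendsto'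
    (tendsto_three_rpow_mul_neg one_div_two_deltaS_pos hE) fun n => ?_) zero_le)
  refine (enorm_le_scale hp u x n).trans_eq ?_
  rw [h, mul_zero, zero_add, mul_left_comm]
  congr 2
  simp only [Int.cast_natCast]
  ring

theorem div_add_lt_one {α ρ : ℝ} (hα : 0 ≤ α) (hρ : 0 ≤ ρ) :
    (α - ρ) / (α + 1 / (2 * deltaS)) < 1 := by
  have := one_div_two_deltaS_pos
  rw [div_lt_one (by linarith)]
  linarith

/-- Functions in `domain` need not be in `L^p`; an infinite norm makes the right side infinite
because the exponent of the energy stays below one. -/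
theorem rpow_mul_rpow_eq_top {E A : ℝ≥0∞} (hE0 : E ≠ 0) (hE : E ≠ ∞) (hA : A = ∞) {s b : ℝ}
    (hb : b < 1) : E ^ s * A ^ (1 - b) = ∞ := by
  rw [hA, ENNReal.top_rpow_of_pos (by linarith), ENNReal.mul_top]
  exact (ENNReal.rpow_pos (pos_iff_ne_zero.2 hE0) hE).ne'

theorem exists_eLpNorm_le {σ : Measure InfGasket} {p q : ℝ≥0∞} (hp : 1 ≤ p) (hpq : p ≤ q)
    (hq : 2 ≤ q) {ρ : ℤ → ℝ} (hρ0 : ∀ k, 0 ≤ ρ k) (hρ : ∀ k, ρ k ≤ 1) (M : ℤ → ℝ≥0∞)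
    (hσ : ∀ k c, σ (dil k ⁻¹' cell c []) ≤ M k)
    (hM : ∀ k, M k ^ q⁻¹.toReal ≤ 3 ^ (-k * ρ k)) {u : C(InfGasket, ℝ)} (hu : u ∈ domain) :
    ∃ k, eLpNorm u q σ ≤
      240 * (energy u ^ ((p⁻¹.toReal - ρ k) / (p⁻¹.toReal + 1 / (2 * deltaS)) / 2) *
        eLpNorm u p hausdorffHat ^
          (1 - (p⁻¹.toReal - ρ k) / (p⁻¹.toReal + 1 / (2 * deltaS)))) := by
  rcases eq_or_ne u 0 with rfl | hu0
  · exact ⟨0, by simp [eLpNorm_zero]⟩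
  have hE0 : energy u ≠ 0 := fun h => hu0 (eq_zero_of_energy_eq_zero hu h)
  have hA0 : eLpNorm u p hausdorffHat ≠ 0 := fun h => hu0 (eq_zero_of_eLpNorm_eq_zero hu hp h)
  rcases eq_or_ne (eLpNorm u p hausdorffHat) ∞ with hA | hA
  · refine ⟨0, ?_⟩
    rw [rpow_mul_rpow_eq_top hE0 hu.1.ne hA (div_add_lt_one ENNReal.toReal_nonneg (hρ0 _))]
    simp
  · refine exists_le_of_forall_scale hE0 hu.1.ne hA0 hA ENNReal.toReal_nonneg hρ0 hρ fun k => ?_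
    refine (eLpNorm_le_scale k (hσ k) hp hpq hq u).trans ?_
    gcongr
    exact hM k

/-! ### The inequalities for the two measures -/

theorem hausdorffHat_preimage_dil_cell (k : ℤ) (c : TileIndex) :
    hausdorffHat (dil k ⁻¹' cell c []) = 3 ^ (-k : ℝ) := by
  rw [← Measure.map_apply (measurable_dil k) (isClosed_cell c []).measurableSet,
    map_dil_hausdorffHat, Measure.smul_apply, hausdorffHat_cell]
  simp

theorem eLpNorm_hausdorffHat_le {p q : ℝ≥0∞} (hp : 1 ≤ p) (hpq : p ≤ q) (hq : 2 ≤ q)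
    {u : C(InfGasket, ℝ)} (hu : u ∈ domain) :
    eLpNorm u q hausdorffHat ≤
      240 * (energy u ^ (expo p q / 2) * eLpNorm u p hausdorffHat ^ (1 - expo p q)) := by
  obtain ⟨k, h⟩ := exists_eLpNorm_le hp hpq hq (ρ := fun _ => q⁻¹.toReal)
    (fun _ => ENNReal.toReal_nonneg) (fun _ => toReal_inv_le_one (hp.trans hpq))
    (fun k => 3 ^ (-k : ℝ)) (fun k c => (hausdorffHat_preimage_dil_cell k c).le)
    (fun k => by rw [ENNReal.rpow_mul]) hu
  exact h

theorem enorm_le_mul_rpow {p : ℝ≥0∞} (hp : 1 ≤ p) {u : C(InfGasket, ℝ)} (hu : u ∈ domain)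
    (x : InfGasket) :
    ‖u x‖ₑ ≤ 240 * (energy u ^ ((p⁻¹.toReal / (p⁻¹.toReal + 1 / (2 * deltaS))) / 2) *
      eLpNorm u p hausdorffHat ^ (1 - p⁻¹.toReal / (p⁻¹.toReal + 1 / (2 * deltaS)))) := by
  obtain ⟨k, h⟩ := exists_eLpNorm_le (σ := Measure.dirac x) hp le_top le_top (ρ := fun _ => 0)
    (fun _ => le_rfl) (fun _ => zero_le_one) (fun _ => 1) (fun _ _ => prob_le_one)
    (fun k => by simp) hu
  simp only [sub_zero] at h
  exact (eLpNorm_top_dirac u x).trans h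

theorem kusuokaWeight_nil : kusuokaWeight [] = 1 := by
  simp [kusuokaWeight, traceWord_nil]

theorem three_fifths_pow (n : ℕ) : ENNReal.ofReal ((3 / 5 : ℝ) ^ n) = 3 ^ (-(n / deltaS)) := by
  rw [← ofReal_three_rpow]
  congr 1
  rw [show -((n : ℝ) / deltaS) = 1 / deltaS * -n by ring, Real.rpow_mul (by norm_num),
    Real.rpow_neg (by positivity), three_rpow_one_div_deltaS, Real.rpow_natCast, ← inv_pow]
  norm_num

theorem kusuokaHat_preimage_dil_le (n : ℕ) (c : TileIndex) :
    kusuokaHat (dil n ⁻¹' cell c []) ≤ 3 ^ (-(n / deltaS)) := by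
  obtain ⟨c', w, hw, h⟩ := exists_preimage_dil_natCast_cell n c []
  rw [h, kusuokaHat_cell, ← three_fifths_pow]
  refine (isMass_kusuoka.le w).trans_eq ?_
  rw [hw]; simp

theorem kusuokaHat_preimage_dil_neg (n : ℕ) (c : TileIndex) :
    kusuokaHat (dil (-n) ⁻¹' cell c []) = 3 ^ n := by
  refine (isMass_kusuoka.cellMeasure_preimage_dil_neg n c).trans ?_
  rw [kusuokaWeight_nil]; simp

theorem toReal_inv_sub_nonneg {p q : ℝ≥0∞} (hp : 1 ≤ p) (hpq : p ≤ q) {δ : ℝ} (hδ : 1 ≤ δ) :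
    0 ≤ p⁻¹.toReal - q⁻¹.toReal / δ := by
  have h1 : q⁻¹.toReal ≤ p⁻¹.toReal := by
    refine ENNReal.toReal_mono (ENNReal.inv_ne_top.2 (zero_lt_one.trans_le hp).ne') ?_
    exact ENNReal.inv_le_inv.2 hpq
  have h2 : q⁻¹.toReal / δ ≤ q⁻¹.toReal := div_le_self ENNReal.toReal_nonneg hδ
  linarith

theorem expoPos_eq {p q : ℝ≥0∞} (hp : 1 ≤ p) (hpq : p ≤ q) {δ : ℝ} (hδ : 1 ≤ δ) :
    expoPos δ p q = (p⁻¹.toReal - q⁻¹.toReal / δ) / (p⁻¹.toReal + 1 / (2 * deltaS)) := by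
  have h := toReal_inv_sub_nonneg hp hpq hδ
  have := one_div_two_deltaS_pos
  have h0 : 0 ≤ p⁻¹.toReal := ENNReal.toReal_nonneg
  exact max_eq_left (by positivity)

theorem expo_eq_expoPos {p q : ℝ≥0∞} (hp : 1 ≤ p) (hpq : p ≤ q) : expo p q = expoPos 1 p q := by
  rw [expoPos_eq hp hpq le_rfl, div_one, expo]

theorem expo_nonneg {p q : ℝ≥0∞} (hp : 1 ≤ p) (hpq : p ≤ q) : 0 ≤ expo p q := by
  rw [expo_eq_expoPos hp hpq]; exact le_max_right _ _

theorem expo_lt_one (p q : ℝ≥0∞) : expo p q < 1 :=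
  div_add_lt_one ENNReal.toReal_nonneg ENNReal.toReal_nonneg

theorem eLpNorm_kusuokaHat_le {p q : ℝ≥0∞} (hp : 1 ≤ p) (hpq : p ≤ q) (hq : 2 ≤ q)
    {u : C(InfGasket, ℝ)} (hu : u ∈ domain) :
    eLpNorm u q kusuokaHat ≤ 240 *
      (energy u ^ (expoPos deltaS p q / 2) * eLpNorm u p hausdorffHat ^ (1 - expoPos deltaS p q) +
        energy u ^ (expoPos 1 p q / 2) * eLpNorm u p hausdorffHat ^ (1 - expoPos 1 p q)) := by
  have hq1 : q⁻¹.toReal ≤ 1 := toReal_inv_le_one (hp.trans hpq)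
  have hq0 : 0 ≤ q⁻¹.toReal := ENNReal.toReal_nonneg
  have hd := one_lt_deltaS
  have hd0 := deltaS_pos
  have hqd : q⁻¹.toReal / deltaS ≤ q⁻¹.toReal := div_le_self hq0 hd.le
  -- Nonnegative `k` means cells of side at most one, of mass at most `3 ^ (-k / deltaS)`; negative
  -- `k` means large cells, of mass `3 ^ (-k)`. The sign of the balancing scale decides which
  -- exponent appears, and the sum of both terms dominates either.
  obtain ⟨k, h⟩ := exists_eLpNorm_le (σ := kusuokaHat) hp hpq hq
    (ρ := fun k => if 0 ≤ k then q⁻¹.toReal / deltaS else q⁻¹.toReal)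
    (fun k => by split_ifs <;> positivity)
    (fun k => by split_ifs <;> linarith)
    (fun k => if 0 ≤ k then 3 ^ (-(k / deltaS)) else 3 ^ (-k : ℝ))
    (fun k c => by
      split_ifs with hk
      · obtain ⟨n, rfl⟩ := Int.eq_ofNat_of_zero_le hk
        exact kusuokaHat_preimage_dil_le n c
      · obtain ⟨n, hn⟩ := Int.eq_ofNat_of_zero_le (a := -k) (by omega)
        obtain rfl : k = -n := by omega
        rw [kusuokaHat_preimage_dil_neg]
        simp)
    (fun k => by
      split_ifs with hk
      · rw [← ENNReal.rpow_mul]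
        exact le_of_eq (by congr 1; ring)
      · rw [← ENNReal.rpow_mul]) hu
  refine h.trans ?_
  gcongr
  split_ifs
  · rw [← expoPos_eq hp hpq hd.le]
    exact le_self_add
  · have e := expoPos_eq hp hpq (le_refl (1 : ℝ))
    rw [div_one] at e
    rw [← e]
    exact le_add_self

/-! ### A harmonic tent function at the origin -/

/-- The values of the tent function at the corners of a cell. -/
def tentValues (c : TileIndex) (w : List (Fin 3)) : Fin 3 → ℝ :=
  open Classical in (Aword w).mulVec fun j => if tile c (corner j) = 0 then 1 else 0

theorem tentValues_append (c : TileIndex) (w : List (Fin 3)) (i : Fin 3) :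
    tentValues c (w ++ [i]) = (A i).mulVec (tentValues c w) := by
  rw [tentValues, tentValues, Matrix.mulVec_mulVec, Aword_append_singleton]

theorem tentValues_nil (c : TileIndex) (j : Fin 3) [Decidable (tile c (corner j) = 0)] :
    tentValues c [] j = if tile c (corner j) = 0 then 1 else 0 := by
  simp [tentValues, Aword]

theorem tentValues_append_replicate (c : TileIndex) (w : List (Fin 3)) (n : ℕ) (i : Fin 3) :
    tentValues c (w ++ List.replicate n i) i = tentValues c w i := by
  induction n with
  | zero => simp
  | succ n ih =>
    rw [List.replicate_succ', ← List.append_assoc, tentValues_append, A_mulVec_self, ih]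

theorem eq_of_vertex_append_eq {c : TileIndex} {w : List (Fin 3)} {i j k : Fin 3}
    (h : vertex c (w ++ [i]) j = vertex c w k) : i = k ∧ j = k := by
  have h1 := tile_injective c (congrArg Subtype.val h)
  rw [Fword_append] at h1
  have h2 : F i (corner j) = corner k := Fword_injective w h1
  obtain rfl := eq_of_F_eq_corner (corner_mem_triangle j) h2
  exact ⟨rfl, corner_injective (F_injective i (h2.trans (F_corner_self i).symm))⟩

/-- Within one parent cell a shared vertex is the same corner of the same cell or a midpoint,
treated by `A_mulVec_swap`. For different parents it must be a corner of both, where the value is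
inherited by `A_mulVec_self`, and induction applies. -/
theorem tentValues_eq_of_vertex_eq {c c' : TileIndex} {w w' : List (Fin 3)}
    (hw : w.length = w'.length) {j j' : Fin 3} (h : vertex c w j = vertex c' w' j') :
    tentValues c w j = tentValues c' w' j' := by
  classical
  induction w using List.reverseRecOn generalizing c c' w' j j' with
  | nil =>
    obtain rfl := List.length_eq_zero_iff.1 hw.symm
    have h1 : tile c (corner j) = tile c' (corner j') := congrArg Subtype.val h
    rw [tentValues_nil, tentValues_nil, h1]
  | append_singleton v i ih =>
    rcases List.eq_nil_or_concat' w' with rfl | ⟨v', i', rfl⟩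
    · simp at hw
    · have hv : v.length = v'.length := by simpa using hw
      by_cases hc : c = c' ∧ v = v'
      · obtain ⟨rfl, rfl⟩ := hc
        have h1 := tile_injective c (congrArg Subtype.val h)
        rw [Fword_append, Fword_append] at h1
        rcases F_corner_eq (Fword_injective v h1) with ⟨rfl, rfl⟩ | ⟨rfl, rfl⟩
        · rfl
        · rw [tentValues_append, tentValues_append, A_mulVec_swap]
      · have hx := cell_append_subset c v [i] (vertex_mem_cell c (v ++ [i]) j)
        have hx' := cell_append_subset c' v' [i'] (vertex_mem_cell c' (v' ++ [i']) j')
        rw [← h] at hx'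
        obtain ⟨⟨k, hk⟩, k', hk'⟩ := eq_vertex_of_mem_cells hv hc hx hx'
        obtain ⟨rfl, rfl⟩ := eq_of_vertex_append_eq hk
        obtain ⟨rfl, rfl⟩ := eq_of_vertex_append_eq (h.symm.trans hk')
        rw [tentValues_append, tentValues_append, A_mulVec_self, A_mulVec_self]
        exact ih hv (hk.symm.trans hk')

theorem quad_tentValues_le (c : TileIndex) (w : List (Fin 3)) :
    quad (tentValues c w) ≤ ((3 / 5) ^ 2) ^ w.length := by
  classical
  induction w using List.reverseRecOn with
  | nil =>
    simp only [quad, tentValues_nil, List.length_nil, pow_zero]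
    split_ifs <;> norm_num
  | append_singleton w i ih =>
    rw [tentValues_append, List.length_append, List.length_singleton, pow_succ']
    exact (quad_A_le i _).trans (by gcongr)

theorem abs_tentValues_sub_le (c : TileIndex) (w : List (Fin 3)) (i j : Fin 3) :
    |tentValues c w i - tentValues c w j| ≤ 2 * (3 / 5) ^ w.length := by
  have h1 := quad_tentValues_le c w
  rw [quad_eq] at h1
  refine abs_le_of_sq_le_sq ?_ (by positivity)
  rw [mul_pow, ← pow_mul, mul_comm w.length, pow_mul]
  have h4 : (0 : ℝ) < ((3 / 5) ^ 2) ^ w.length := by positivity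
  generalize ((3 / 5 : ℝ) ^ 2) ^ w.length = t at *
  fin_cases i <;> fin_cases j <;> simp <;>
    nlinarith [sq_nonneg (tentValues c w 0 - tentValues c w 1),
      sq_nonneg (tentValues c w 1 - tentValues c w 2),
      sq_nonneg (tentValues c w 0 - tentValues c w 2)]

/-- Telescoping as for the oscillation: the bounds `2 * (3/5) ^ k` have the total sum 5. -/
theorem abs_tentValues_append_sub_le (c : TileIndex) (w v : List (Fin 3)) (i j : Fin 3) :
    |tentValues c (w ++ v) i - tentValues c w j| ≤ 5 * (3 / 5) ^ w.length := by
  suffices h : |tentValues c (w ++ v) i - tentValues c w j| ≤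
      (5 - 3 * (3 / 5) ^ v.length) * (3 / 5) ^ w.length by
    refine h.trans ?_
    gcongr
    have : (0 : ℝ) < (3 / 5) ^ v.length := by positivity
    linarith
  induction v using List.reverseRecOn generalizing i with
  | nil =>
    rw [List.append_nil]
    exact (abs_tentValues_sub_le c w i j).trans (by norm_num)
  | append_singleton v k ih =>
    have h1 := abs_tentValues_sub_le c (w ++ v ++ [k]) i k
    have h2 : tentValues c (w ++ v ++ [k]) k = tentValues c (w ++ v) k := by
      rw [tentValues_append, A_mulVec_self]
    have h3 := abs_sub_le (tentValues c (w ++ v ++ [k]) i) (tentValues c (w ++ v) k)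
      (tentValues c w j)
    rw [h2, List.length_append, List.length_append, List.length_singleton, pow_succ, pow_add] at h1
    rw [← List.append_assoc, List.length_append, List.length_singleton, pow_succ]
    nlinarith [ih k]

/-- If the truncation `v` of `w'` gives another cell than `w`, the comparison passes through a
common corner of both; the costs 2 and 5 stay below 9. -/
theorem abs_tentValues_sub_le_of_mem {x : InfGasket} {c c' : TileIndex} {w w' : List (Fin 3)}
    (hw : w.length ≤ w'.length) (hx : x ∈ cell c w) (hx' : x ∈ cell c' w') (i i' : Fin 3) :
    |tentValues c w i - tentValues c' w' i'| ≤ 9 * (3 / 5) ^ w.length := by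
  obtain ⟨v, v', rfl, hv⟩ : ∃ v v', w' = v ++ v' ∧ w.length = v.length :=
    ⟨w'.take w.length, w'.drop w.length, (List.take_append_drop _ _).symm, by simp [hw]⟩
  have h1 := abs_tentValues_append_sub_le c' v v'
  have hxv := cell_append_subset c' v v' hx'
  rw [← hv] at h1
  by_cases hc : c = c' ∧ w = v
  · obtain ⟨rfl, rfl⟩ := hc
    rw [abs_sub_comm]
    exact (h1 i' i).trans (by gcongr; norm_num)
  · obtain ⟨⟨k, hk⟩, k', hk'⟩ := eq_vertex_of_mem_cells hv hc hx hxv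
    have e := tentValues_eq_of_vertex_eq hv (hk.symm.trans hk')
    have h2 := abs_tentValues_sub_le c w i k
    have h4 := h1 i' k'
    rw [abs_sub_comm, ← e] at h4
    have h5 := abs_sub_le (tentValues c w i) (tentValues c w k) (tentValues c' (v ++ v') i')
    have : (0 : ℝ) < (3 / 5) ^ w.length := by positivity
    linarith

/-- The values on shrinking cells around `x` form a Cauchy sequence. Stating the limit's error bound
for every cell containing `x` makes it independent of the chosen cells. -/
theorem exists_tent_value (x : InfGasket) : ∃ r : ℝ, ∀ c w j, x ∈ cell c w →
    |r - tentValues c w j| ≤ 9 * (3 / 5) ^ w.length := by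
  choose c w hw hx using fun n => exists_mem_cell x n
  have hlim : Tendsto (fun n : ℕ => 9 * (3 / 5 : ℝ) ^ n) atTop (𝓝 0) := by
    simpa using (tendsto_pow_atTop_nhds_zero_of_lt_one (r := (3 / 5 : ℝ)) (by norm_num)
      (by norm_num)).const_mul 9
  have hcau : CauchySeq fun n => tentValues (c n) (w n) 0 := by
    refine cauchySeq_of_le_tendsto_0' _ (fun n m hnm => ?_) hlim
    rw [Real.dist_eq]
    simpa only [hw] using abs_tentValues_sub_le_of_mem (by rwa [hw, hw]) (hx n) (hx m) 0 0
  obtain ⟨r, hr⟩ := cauchySeq_tendsto_of_complete hcau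
  refine ⟨r, fun c' w' j hx' => le_of_tendsto (hr.sub_const _).abs ?_⟩
  filter_upwards [eventually_ge_atTop w'.length] with n hn
  rw [abs_sub_comm]
  exact abs_tentValues_sub_le_of_mem (by rwa [hw]) hx' (hx n) j 0

/-- The function on the infinite gasket which is harmonic on all unit cells, equal to `1` at the
origin and to `0` at all other corners of the unit cells. -/
def tent : C(InfGasket, ℝ) where
  toFun x := (exists_tent_value x).choose
  continuous_toFun := by
    refine continuous_iff_continuousAt.2 fun x => Metric.tendsto_nhds.2 fun ε hε => ?_
    have hlim : Tendsto (fun n : ℕ => 18 * (3 / 5 : ℝ) ^ n) atTop (𝓝 0) := by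
      simpa using (tendsto_pow_atTop_nhds_zero_of_lt_one (r := (3 / 5 : ℝ)) (by norm_num)
        (by norm_num)).const_mul 18
    obtain ⟨n, hn⟩ := (hlim.eventually_lt_const hε).exists
    filter_upwards [eventually_mem_cell x n] with y hy
    obtain ⟨c, w, hw, hyw⟩ := exists_mem_cell y n
    have h1 := (exists_tent_value x).choose_spec c w 0 (hy c w hw hyw)
    have h2 := (exists_tent_value y).choose_spec c w 0 hyw
    rw [hw] at h1 h2
    rw [abs_sub_comm] at h1
    rw [Real.dist_eq]
    have h3 := abs_sub_le (exists_tent_value y).choose (tentValues c w 0)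
      (exists_tent_value x).choose
    linarith

theorem abs_tent_sub_le {x : InfGasket} {c : TileIndex} {w : List (Fin 3)} (hx : x ∈ cell c w)
    (j : Fin 3) : |tent x - tentValues c w j| ≤ 9 * (3 / 5) ^ w.length :=
  (exists_tent_value x).choose_spec c w j hx

theorem eq_of_abs_sub_le_pow {a b : ℝ} (h : ∀ n : ℕ, |a - b| ≤ 9 * (3 / 5) ^ n) : a = b := by
  have hlim : Tendsto (fun n : ℕ => 9 * (3 / 5 : ℝ) ^ n) atTop (𝓝 0) := by
    simpa using (tendsto_pow_atTop_nhds_zero_of_lt_one (r := (3 / 5 : ℝ)) (by norm_num)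
      (by norm_num)).const_mul 9
  exact sub_eq_zero.1 (abs_nonpos_iff.1 (ge_of_tendsto' hlim h))

theorem cellValues_tent (c : TileIndex) (w : List (Fin 3)) :
    cellValues tent c w = tentValues c w := by
  funext i
  refine eq_of_abs_sub_le_pow fun n => ?_
  have hx : vertex c w i ∈ cell c (w ++ List.replicate n i) := by
    rw [← vertex_append_self c w n i]; exact vertex_mem_cell _ _ _
  have h := abs_tent_sub_le hx i
  rw [tentValues_append_replicate] at h
  refine h.trans ?_
  gcongr 9 * ?_
  exact pow_le_pow_of_le_one (by norm_num) (by norm_num) (by simp)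

/-- By `sum_quad_A` each harmonic refinement preserves the renormalized energy, so finiteness is
already visible at level zero. -/
theorem tileEnergy_tent (m : ℕ) (c : TileIndex) :
    tileEnergy m tent c = ENNReal.ofReal (3 * quad (tentValues c [])) := by
  induction m with
  | zero => simp [tileEnergy, cellValues_tent]
  | succ m ih =>
    rw [← ih]
    simp only [tileEnergy, cellValues_tent]
    rw [sum_ofFn_succ_last m fun w =>
      ENNReal.ofReal (3 * (5 / 3) ^ (m + 1) * quad (tentValues c w))]
    refine Finset.sum_congr rfl fun w _ => ?_
    rw [← ENNReal.ofReal_sum_of_nonneg fun i _ => mul_nonneg (by positivity) (quad_nonneg _),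
      ← Finset.mul_sum]
    simp only [tentValues_append]
    rw [sum_quad_A, pow_succ]
    congr 1
    ring

/-- The unit cell which has the origin as its corner `0`. -/
def originTile : TileIndex := (1, 0)

theorem tile_originTile (x : Plane) : tile originTile x = x := by
  simp [tile, originTile]

/-- The origin of the infinite gasket. -/
def origin : InfGasket := vertex originTile [] 0

theorem coe_origin : (origin : Plane) = 0 :=
  (tile_originTile _).trans corner_zero

theorem tentValues_nil_eq_zero {c : TileIndex} (h : origin ∉ cell c []) :
    tentValues c [] = 0 := by
  classical
  funext j
  rw [tentValues_nil, if_neg, Pi.zero_apply]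
  intro hj
  refine h ?_
  convert vertex_mem_cell c [] j
  exact Subtype.ext (coe_origin.trans hj.symm)

theorem energy_tent_lt_top : energy tent < ∞ := by
  have hfin := finite_setOf_mem_cell origin
  have hlevel : ∀ m, energyLevel m tent =
      ∑ c ∈ hfin.toFinset, ENNReal.ofReal (3 * quad (tentValues c [])) := by
    intro m
    rw [energyLevel_eq]
    simp only [tileEnergy_tent]
    refine tsum_eq_sum fun c hc => ?_
    rw [tentValues_nil_eq_zero (by simpa using hc)]
    simp [quad]
  rw [energy]
  simp only [hlevel, ciSup_const]
  exact ENNReal.sum_lt_top.2 fun _ _ => ENNReal.ofReal_lt_top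

theorem tent_eq_zero {x : InfGasket} {c : TileIndex} (hx : x ∈ cell c [])
    (h : origin ∉ cell c []) : tent x = 0 := by
  refine eq_of_abs_sub_le_pow fun n => ?_
  obtain ⟨v, hv, hxv⟩ := exists_mem_cell_append hx n
  have h1 := abs_tent_sub_le hxv 0
  rw [List.nil_append] at h1
  have : tentValues c v = 0 := by
    have h0 := tentValues_nil_eq_zero h
    rw [tentValues] at h0 ⊢
    rw [Aword, Matrix.one_mulVec] at h0
    rw [h0, Matrix.mulVec_zero]
  rw [this, hv] at h1
  exact h1

theorem abs_tent_le (x : InfGasket) : |tent x| ≤ 10 := by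
  classical
  obtain ⟨c, w, hw, hx⟩ := exists_mem_cell x 0
  obtain rfl := List.length_eq_zero_iff.1 hw
  have h1 := abs_tent_sub_le hx 0
  have h2 : |tentValues c [] 0| ≤ 1 := by
    rw [tentValues_nil]; split_ifs <;> simp
  have h3 := abs_sub_abs_le_abs_sub (tent x) (tentValues c [] 0)
  simp at h1
  linarith

theorem memLp_tent (p : ℝ≥0∞) : MemLp tent p hausdorffHat := by
  have hfin := finite_setOf_mem_cell origin
  set B : Set InfGasket := ⋃ c ∈ {c | origin ∈ cell c []}, cell c []
  have hB : hausdorffHat B < ∞ := by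
    refine measure_biUnion_lt_top hfin fun c _ => ?_
    rw [hausdorffHat_cell]; simp
  have hsupp : Function.support tent ⊆ B := by
    intro x hx
    obtain ⟨c, w, hw, hxc⟩ := exists_mem_cell x 0
    obtain rfl := List.length_eq_zero_iff.1 hw
    refine Set.mem_biUnion (x := c) ?_ hxc
    by_contra h
    exact hx (tent_eq_zero hxc h)
  have : IsFiniteMeasure (hausdorffHat.restrict B) := ⟨by simpa using hB⟩
  have hm : MemLp tent p (hausdorffHat.restrict B) :=
    MemLp.of_bound tent.continuous.aestronglyMeasurable 10 (Eventually.of_forall abs_tent_le)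
  refine ⟨tent.continuous.aestronglyMeasurable, ?_⟩
  rw [← eLpNorm_restrict_eq_of_support_subset hsupp]
  exact hm.2

theorem tent_mem_domain : tent ∈ domain := ⟨energy_tent_lt_top, memLp_tent 2⟩

theorem tentValues_replicate (n : ℕ) : tentValues originTile (List.replicate n 0) 0 = 1 := by
  classical
  have := tentValues_append_replicate originTile [] n 0
  rw [List.nil_append] at this
  rw [this, tentValues_nil, tile_originTile, if_pos corner_zero]

/-- A cell around the origin on which the tent function is at least `1/2`. -/
def core : Set InfGasket := cell originTile (List.replicate 6 0)

/-- The six letters in `core` are needed for `9 * (3/5) ^ 6 < 1/2`, as `tent` equals 1 at the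
origin. -/
theorem half_le_tent {x : InfGasket} (hx : x ∈ core) : 1 / 2 ≤ tent x := by
  have h := abs_tent_sub_le hx 0
  rw [tentValues_replicate, List.length_replicate, abs_le] at h
  norm_num at h
  linarith [h.1]

theorem tent_ne_zero : tent ≠ 0 := by
  intro h
  have := half_le_tent (vertex_mem_cell originTile (List.replicate 6 0) 0)
  rw [h] at this
  norm_num at this

theorem le_eLpNorm_tent_comp_dil {σ : Measure InfGasket} {q : ℝ≥0∞} (hq : q ≠ 0) (k : ℤ)
    (hσ : σ (dil k ⁻¹' core) ≠ 0) :
    2⁻¹ * σ (dil k ⁻¹' core) ^ q⁻¹.toReal ≤ eLpNorm (tent.comp (dil k)) q σ := by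
  have hmeas : MeasurableSet (dil k ⁻¹' core) :=
    ((isClosed_cell _ _).preimage (dil k).continuous).measurableSet
  have hne : σ.restrict (dil k ⁻¹' core) ≠ 0 := by
    rwa [Ne, Measure.restrict_eq_zero]
  calc _ = eLpNorm (fun _ => (2⁻¹ : ℝ)) q (σ.restrict (dil k ⁻¹' core)) := by
        rw [eLpNorm_const _ hq hne, Measure.restrict_apply_univ, one_div, ENNReal.toReal_inv,
          Real.enorm_eq_ofReal_abs, abs_of_pos (by norm_num), ENNReal.ofReal_inv_of_pos two_pos]
        norm_num
    _ ≤ eLpNorm (tent.comp (dil k)) q (σ.restrict (dil k ⁻¹' core)) := by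
        refine eLpNorm_mono_ae ?_
        filter_upwards [ae_restrict_mem hmeas] with x hx
        have h1 := half_le_tent hx
        rw [Real.norm_eq_abs, Real.norm_eq_abs, abs_of_pos (by norm_num)]
        exact (by simpa using h1 : 2⁻¹ ≤ tent (dil k x)).trans (le_abs_self _)
    _ ≤ _ := eLpNorm_mono_measure _ Measure.restrict_le_self

theorem consEquiv_originTile : consEquiv (originTile, 0) = originTile := by
  refine Prod.ext rfl ?_
  ext n : 1
  cases n <;> rfl

theorem preimage_dil_cell_originTile (n : ℕ) (w : List (Fin 3)) :
    dil n ⁻¹' cell originTile w = cell originTile (List.replicate n 0 ++ w) := by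
  induction n generalizing w with
  | zero => ext x; simp [dil_zero]
  | succ n ih =>
    have h := preimage_dil_one_cell originTile 0 (List.replicate n 0 ++ w)
    rw [consEquiv_originTile, ← ih, preimage_dil_dil] at h
    rw [List.replicate_succ, List.cons_append, ← h]
    push_cast
    rfl

theorem kusuokaHat_preimage_dil_core (n : ℕ) :
    ENNReal.ofReal (1 / 6 * (3 / 5) ^ (n + 6)) ≤ kusuokaHat (dil n ⁻¹' core) := by
  rw [core, preimage_dil_cell_originTile, kusuokaHat_cell, List.replicate_append_replicate]
  exact ENNReal.ofReal_le_ofReal (le_kusuokaWeight_replicate _)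

theorem kusuokaHat_preimage_dil_neg_core (n : ℕ) :
    kusuokaHat (dil (-(n + 6 : ℕ)) ⁻¹' core) = 3 ^ n := by
  have h : core = dil (6 : ℕ) ⁻¹' cell originTile [] := by
    rw [preimage_dil_cell_originTile, List.append_nil, core]
  have e : ((6 : ℕ) : ℤ) + -((n + 6 : ℕ) : ℤ) = -n := by push_cast; ring
  rw [h, preimage_dil_dil, e, kusuokaHat_preimage_dil_neg]

/-! ### Necessary conditions on the exponents -/

theorem false_of_forall_le_sum {N : ℕ} {c : ℝ≥0∞} (hc : c ≠ 0) {K : Fin N → ℝ≥0∞}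
    (hK : ∀ i, K i ≠ ∞) {θ : Fin N → ℝ} (hθ : ∀ i, 0 < θ i) (n₀ : ℕ)
    (h : ∀ n : ℕ, n₀ ≤ n → c ≤ ∑ i, 3 ^ (-(n * θ i)) * K i) : False := by
  have hlim : Tendsto (fun n : ℕ => ∑ i, (3 : ℝ≥0∞) ^ (-(n * θ i)) * K i) atTop (𝓝 0) := by
    have := tendsto_finsetSum Finset.univ fun i (_ : i ∈ Finset.univ) =>
      tendsto_three_rpow_mul_neg (hθ i) (hK i)
    simpa using this
  refine hc (le_antisymm (ge_of_tendsto hlim ?_) zero_le)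
  filter_upwards [eventually_ge_atTop n₀] with n hn using h n hn

/-- The sign `s = ±1` selects small or large scales, and `ρ` is the scaling rate of the left side.
If all `b i` lay strictly on the wrong side of the critical exponent, then after division by this
rate every term on the right would decay geometrically in `n`, while the left stays at least `c`. -/
theorem exists_exponent_of_sobolevIneq {σ : Measure InfGasket} {p q : ℝ≥0∞} (hp : 1 ≤ p) {N : ℕ}
    {b : Fin N → ℝ} {C : ℝ≥0} (h : SobolevIneq σ p q b C) {c : ℝ≥0∞} (hc : c ≠ 0) {ρ : ℝ} (s : ℤ)
    (n₀ : ℕ)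
    (hn : ∀ n : ℕ, n₀ ≤ n →
      c * 3 ^ (-(s * n * ρ)) ≤ eLpNorm (tent.comp (dil (s * n))) q σ) :
    ∃ i, (0 : ℝ) ≤ s * (b i - (p⁻¹.toReal - ρ) / (p⁻¹.toReal + 1 / (2 * deltaS))) := by
  by_contra! hcon
  set α := p⁻¹.toReal
  set D := α + 1 / (2 * deltaS)
  have hD : 0 < D := add_pos_of_nonneg_of_pos ENNReal.toReal_nonneg one_div_two_deltaS_pos
  set E := energy tent
  set T := eLpNorm tent p hausdorffHat
  have hE0 : E ≠ 0 := fun h => tent_ne_zero (eq_zero_of_energy_eq_zero tent_mem_domain h)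
  have hE : E ≠ ∞ := energy_tent_lt_top.ne
  have hT0 : T ≠ 0 := fun h => tent_ne_zero (eq_zero_of_eLpNorm_eq_zero tent_mem_domain hp h)
  have hT : T ≠ ∞ := (memLp_tent p).2.ne
  refine false_of_forall_le_sum hc (K := fun i => C * (E ^ (b i / 2) * T ^ (1 - b i)))
    (θ := fun i => -(s * (b i - (α - ρ) / D)) * D) (fun i => ?_)
    (fun i => mul_pos (neg_pos.2 (hcon i)) hD) n₀ fun n hnn => ?_
  · exact ENNReal.mul_ne_top ENNReal.coe_ne_top (ENNReal.mul_ne_top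
      (ENNReal.rpow_ne_top_of_ne_zero hE0 hE) (ENNReal.rpow_ne_top_of_ne_zero hT0 hT))
  · have h1 := (hn n hnn).trans (h _ (comp_dil_mem_domain tent_mem_domain (s * n)))
    rw [energy_comp_dil, eLpNorm_comp_dil_hausdorffHat] at h1
    calc c = c * 3 ^ (-(s * n * ρ)) * 3 ^ (s * n * ρ) := by
          rw [mul_assoc, ← three_rpow_add, neg_add_cancel, ENNReal.rpow_zero, mul_one]
      _ ≤ _ := mul_le_mul_left h1 _
      _ = _ := by
          rw [mul_assoc, Finset.sum_mul, Finset.mul_sum]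
          refine Finset.sum_congr rfl fun i _ => ?_
          rw [ENNReal.mul_rpow_of_ne_zero (three_rpow_ne_zero _) hE0,
            ENNReal.mul_rpow_of_ne_zero (three_rpow_ne_zero _) hT0, ← ENNReal.rpow_mul,
            ← ENNReal.rpow_mul]
          have e : (-(n * (-(s * (b i - (α - ρ) / D)) * D)) : ℝ) =
              ((s * n : ℤ) : ℝ) / deltaS * (b i / 2) +
              (-((s * n : ℤ) : ℝ) * α * (1 - b i) + s * n * ρ) := by
            have h2 : (b i - (α - ρ) / D) * D = b i * D - (α - ρ) := by
              rw [sub_mul, div_mul_cancel₀ _ hD.ne']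
            have h3 : D = α + 1 / (2 * deltaS) := rfl
            push_cast
            calc _ = s * n * ((b i - (α - ρ) / D) * D) := by ring
              _ = _ := by rw [h2, h3]; ring
          rw [e, three_rpow_add, three_rpow_add]
          ring

theorem exists_exponents_hausdorffHat {p q : ℝ≥0∞} (hp : 1 ≤ p) (hpq : p ≤ q) {N : ℕ}
    {b : Fin N → ℝ} {C : ℝ≥0} (h : SobolevIneq hausdorffHat p q b C) :
    (∃ i, b i ≤ expo p q) ∧ ∃ i, expo p q ≤ b i := by
  have hc : eLpNorm tent q hausdorffHat ≠ 0 := fun h =>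
    tent_ne_zero (eq_zero_of_eLpNorm_eq_zero tent_mem_domain (hp.trans hpq) h)
  have key : ∀ (s : ℤ) (n : ℕ), eLpNorm tent q hausdorffHat * 3 ^ (-(s * n * q⁻¹.toReal)) ≤
      eLpNorm (tent.comp (dil (s * n))) q hausdorffHat := fun s n => by
    rw [eLpNorm_comp_dil_hausdorffHat, mul_comm]
    push_cast
    rw [neg_mul]
  obtain ⟨i, hi⟩ := exists_exponent_of_sobolevIneq hp h hc (-1) 0 fun n _ => key (-1) n
  obtain ⟨j, hj⟩ := exists_exponent_of_sobolevIneq hp h hc 1 0 fun n _ => key 1 n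
  refine ⟨⟨i, ?_⟩, j, ?_⟩
  · rw [expo]; push_cast at hi; linarith
  · rw [expo]; push_cast at hj; linarith

theorem exists_exponents_kusuokaHat {p q : ℝ≥0∞} (hp : 1 ≤ p) (hpq : p ≤ q) {N : ℕ}
    {b : Fin N → ℝ} {C : ℝ≥0} (h : SobolevIneq kusuokaHat p q b C) :
    (∃ i, b i ≤ expoPos 1 p q) ∧ ∃ i, expoPos deltaS p q ≤ b i := by
  have hq0 : q ≠ 0 := (zero_lt_one.trans_le (hp.trans hpq)).ne'
  rw [expoPos_eq hp hpq le_rfl, expoPos_eq hp hpq one_lt_deltaS.le, div_one]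
  set β := q⁻¹.toReal
  have hβ : 0 ≤ β := ENNReal.toReal_nonneg
  -- Large scales: once `core` is enlarged by at least `2 ^ 6` it is a union of unit cells, so its
  -- mass is exact. The shift by six goes into the constant.
  obtain ⟨i, hi⟩ := exists_exponent_of_sobolevIneq hp h (c := 2⁻¹ * 3 ^ (-(6 * β))) (ρ := β)
    (mul_ne_zero (by norm_num) (three_rpow_ne_zero _)) (-1) 6 <| by
      intro n hn
      obtain ⟨m, rfl⟩ := Nat.exists_eq_add_of_le' hn
      have hm := kusuokaHat_preimage_dil_neg_core m
      have := le_eLpNorm_tent_comp_dil (σ := kusuokaHat) hq0 (-(m + 6 : ℕ)) (by rw [hm]; simp)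
      rw [hm, ← ENNReal.rpow_natCast, ← ENNReal.rpow_mul] at this
      rw [neg_one_mul]
      refine le_trans (le_of_eq ?_) this
      rw [mul_assoc, ← three_rpow_add]
      congr 2
      push_cast; ring
  -- Small scales: the cells shrink to the origin, where the Kusuoka mass decays at the slowest
  -- possible rate.
  obtain ⟨j, hj⟩ := exists_exponent_of_sobolevIneq hp h
    (c := 2⁻¹ * ENNReal.ofReal (1 / 6 * (3 / 5) ^ 6) ^ β) (ρ := β / deltaS)
    (mul_ne_zero (by norm_num) (ENNReal.rpow_pos (ENNReal.ofReal_pos.2 (by norm_num))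
      ENNReal.ofReal_ne_top).ne') 1 0 <| by
      intro n _
      have hm := kusuokaHat_preimage_dil_core n
      have := le_eLpNorm_tent_comp_dil (σ := kusuokaHat) hq0 n
        ((ENNReal.ofReal_pos.2 (by positivity)).trans_le hm).ne'
      rw [one_mul]
      refine le_trans ?_ (le_trans (mul_le_mul_right (ENNReal.rpow_le_rpow hm hβ) _) this)
      have e : ENNReal.ofReal (1 / 6 * (3 / 5) ^ (n + 6)) =
          ENNReal.ofReal (1 / 6 * (3 / 5) ^ 6) * 3 ^ (-(n / deltaS)) := by
        rw [← three_fifths_pow, ← ENNReal.ofReal_mul (by positivity)]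
        congr 1; ring
      rw [e, ENNReal.mul_rpow_of_nonneg _ _ hβ, ← ENNReal.rpow_mul, ← mul_assoc]
      refine le_of_eq ?_
      congr 2
      push_cast; ring
  refine ⟨⟨i, ?_⟩, j, ?_⟩
  · push_cast at hi; linarith
  · push_cast at hj; linarith

theorem expoPos_one_le {p q : ℝ≥0∞} (hp : 1 ≤ p) (hpq : p ≤ q) :
    expoPos 1 p q ≤ expoPos deltaS p q := by
  rw [expoPos_eq hp hpq le_rfl, expoPos_eq hp hpq one_lt_deltaS.le]
  have hD : 0 < p⁻¹.toReal + 1 / (2 * deltaS) :=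
    add_pos_of_nonneg_of_pos ENNReal.toReal_nonneg one_div_two_deltaS_pos
  have hq : 0 ≤ q⁻¹.toReal := ENNReal.toReal_nonneg
  have := one_lt_deltaS
  gcongr

theorem sobolevIneq_of_exponents {σ : Measure InfGasket} {p q : ℝ≥0∞} (hp : 1 ≤ p) {a : ℝ}
    (ha : a < 1) {K : ℝ≥0}
    (h : ∀ u ∈ domain, eLpNorm u q σ ≤
      K * (energy u ^ (a / 2) * eLpNorm u p hausdorffHat ^ (1 - a)))
    {N : ℕ} {b : Fin N → ℝ} {i j : Fin N} (hi : b i ≤ a) (hj : a ≤ b j) :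
    SobolevIneq σ p q b K := by
  intro u hu
  rcases eq_or_ne u 0 with rfl | hu0
  · simp [eLpNorm_zero]
  refine (h u hu).trans ?_
  gcongr
  have hE0 : energy u ≠ 0 := fun h => hu0 (eq_zero_of_energy_eq_zero hu h)
  have hA0 : eLpNorm u p hausdorffHat ≠ 0 := fun h => hu0 (eq_zero_of_eLpNorm_eq_zero hu hp h)
  have hsingle : ∀ l, energy u ^ (b l / 2) * eLpNorm u p hausdorffHat ^ (1 - b l) ≤
      ∑ i, energy u ^ (b i / 2) * eLpNorm u p hausdorffHat ^ (1 - b i) := fun l =>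
    Finset.single_le_sum (f := fun l => energy u ^ (b l / 2) *
      eLpNorm u p hausdorffHat ^ (1 - b l)) (fun _ _ => zero_le) (Finset.mem_univ l)
  -- For an infinite norm the term with `b i ≤ a < 1` is already infinite.
  rcases eq_or_ne (eLpNorm u p hausdorffHat) ∞ with hA | hA
  · refine le_trans ?_ (hsingle i)
    rw [rpow_mul_rpow_eq_top hE0 hu.1.ne hA (hi.trans_lt ha)]
    exact le_top
  · obtain ⟨x, hx⟩ := exists_eq_three_rpow hE0 hu.1.ne
    obtain ⟨y, hy⟩ := exists_eq_three_rpow hA0 hA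
    have e : ∀ t : ℝ, energy u ^ (t / 2) * eLpNorm u p hausdorffHat ^ (1 - t) =
        3 ^ (y + t * (x / 2 - y)) := fun t => by
      rw [hx, hy, ← ENNReal.rpow_mul, ← ENNReal.rpow_mul, ← three_rpow_add]
      congr 1; ring
    -- The logarithm of each term is affine in its exponent, so the term at `a` is dominated by the
    -- one at `b j` or at `b i`, according to the sign of the slope.
    rcases le_total 0 (x / 2 - y) with hs | hs
    · refine le_trans ?_ (hsingle j)
      rw [e, e]
      apply three_rpow_mono
      nlinarith
    · refine le_trans ?_ (hsingle i)
      rw [e, e]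
      apply three_rpow_mono
      nlinarith

theorem sobolevIneq_hausdorffHat {p q : ℝ≥0∞} (hp : 1 ≤ p) (hpq : p ≤ q) (hq : 2 ≤ q)
    {N : ℕ} {b : Fin N → ℝ} {i j : Fin N} (hi : b i ≤ expo p q) (hj : expo p q ≤ b j) :
    SobolevIneq hausdorffHat p q b 240 :=
  sobolevIneq_of_exponents hp (expo_lt_one p q)
    (fun _ hu => by simpa using eLpNorm_hausdorffHat_le hp hpq hq hu) hi hj

theorem sobolevIneq_kusuokaHat {p q : ℝ≥0∞} (hp : 1 ≤ p) (hpq : p ≤ q) (hq : 2 ≤ q) :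
    SobolevIneq kusuokaHat p q ![expoPos deltaS p q, expoPos 1 p q] 240 := by
  intro u hu
  simpa [Fin.sum_univ_two] using eLpNorm_kusuokaHat_le hp hpq hq hu

theorem exists_sobolevIneq_hausdorffHat_iff {p q : ℝ≥0∞} (hp : 1 ≤ p) (hpq : p ≤ q) (hq : 2 ≤ q)
    {N : ℕ} (b : Fin N → ℝ) :
    (∃ C : ℝ≥0, SobolevIneq hausdorffHat p q b C) ↔
      (∃ i, b i ≤ expo p q) ∧ ∃ i, expo p q ≤ b i :=
  ⟨fun ⟨_, h⟩ => exists_exponents_hausdorffHat hp hpq h,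
    fun ⟨⟨_, hi⟩, _, hj⟩ => ⟨240, sobolevIneq_hausdorffHat hp hpq hq hi hj⟩⟩

end Sierpinski

end

theorem mainTheorem7 :
    -- the defining properties of the Hausdorff measure and of the Kusuoka measure
    (∀ (c : Sierpinski.TileIndex) (w : List (Fin 3)),
      Sierpinski.hausdorffHat (Sierpinski.cell c w) = (3 : ℝ≥0∞)⁻¹ ^ w.length) ∧
    (∀ (c : Sierpinski.TileIndex) (w : List (Fin 3)),
      Sierpinski.kusuokaHat (Sierpinski.cell c w) =
        ENNReal.ofReal (Sierpinski.kusuokaWeight w)) ∧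
    -- (a), the inequality for the Hausdorff measure
    (∃ C : ℝ≥0, ∀ p q : ℝ≥0∞, 1 ≤ p → p ≤ q → 2 ≤ q →
      0 ≤ Sierpinski.expo p q ∧ Sierpinski.expo p q < 1 ∧
      Sierpinski.SobolevIneq Sierpinski.hausdorffHat p q
        ![Sierpinski.expo p q, Sierpinski.expo p q] C) ∧
    -- (a), the bound for the maximum
    (∃ C : ℝ≥0, ∀ p : ℝ≥0∞, 1 ≤ p → ∀ u ∈ Sierpinski.domain, ∀ x : Sierpinski.InfGasket,
      ‖u x‖ₑ ≤ C * (Sierpinski.energy u ^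
            ((p⁻¹.toReal / (p⁻¹.toReal + 1 / (2 * Sierpinski.deltaS))) / 2) *
          eLpNorm u p Sierpinski.hausdorffHat ^
            (1 - p⁻¹.toReal / (p⁻¹.toReal + 1 / (2 * Sierpinski.deltaS))))) ∧
    -- (a), the admissible exponents
    (∀ p q : ℝ≥0∞, 1 ≤ p → p ≤ q → 2 ≤ q →
      (∀ b : ℝ, (∃ C : ℝ≥0, Sierpinski.SobolevIneq Sierpinski.hausdorffHat p q ![b, b] C) ↔
        b = Sierpinski.expo p q) ∧
      (∀ (N : ℕ) (b : Fin N → ℝ),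
        (∃ C : ℝ≥0, Sierpinski.SobolevIneq Sierpinski.hausdorffHat p q b C) ↔
          (∃ i, b i ≤ Sierpinski.expo p q) ∧ (∃ i, Sierpinski.expo p q ≤ b i))) ∧
    -- (b), the inequality for the Kusuoka measure
    (∃ C : ℝ≥0, ∀ p q : ℝ≥0∞, 1 ≤ p → p ≤ q → 2 ≤ q →
      Sierpinski.SobolevIneq Sierpinski.kusuokaHat p q
        ![Sierpinski.expoPos Sierpinski.deltaS p q, Sierpinski.expoPos 1 p q] C) ∧
    -- (b), the optimality of the pair of exponents
    (∀ p q : ℝ≥0∞, 1 ≤ p → p ≤ q → 2 ≤ q → ∀ (N : ℕ) (b : Fin N → ℝ),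
      (∃ C : ℝ≥0, Sierpinski.SobolevIneq Sierpinski.kusuokaHat p q b C) →
        (∃ i, b i ≤ Sierpinski.expoPos 1 p q) ∧
        Sierpinski.expoPos 1 p q ≤ Sierpinski.expoPos Sierpinski.deltaS p q ∧
        (∃ i, Sierpinski.expoPos Sierpinski.deltaS p q ≤ b i)) ∧
    -- the growth rate of the traces
    (∀ ω : ℕ → Fin 3, limsup (Sierpinski.traceRoot ω) atTop ≤ (3 / 5) ^ 2) ∧
    IsLUB {L : ℝ | ∃ ω : ℕ → Fin 3, Tendsto (Sierpinski.traceRoot ω) atTop (𝓝 L)}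
      ((3 / 5) ^ 2) := by
  refine ⟨Sierpinski.hausdorffHat_cell, Sierpinski.kusuokaHat_cell,
    ⟨240, fun p q hp hpq hq => ⟨Sierpinski.expo_nonneg hp hpq, Sierpinski.expo_lt_one p q,
      Sierpinski.sobolevIneq_hausdorffHat hp hpq hq (i := 0) (j := 0) le_rfl le_rfl⟩⟩,
    ⟨240, fun p hp u hu x => by simpa using Sierpinski.enorm_le_mul_rpow hp hu x⟩,
    fun p q hp hpq hq => ⟨fun b => ?_,
      fun N b => Sierpinski.exists_sobolevIneq_hausdorffHat_iff hp hpq hq b⟩,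
    ⟨240, fun p q hp hpq hq => Sierpinski.sobolevIneq_kusuokaHat hp hpq hq⟩,
    fun p q hp hpq hq N b ⟨C, h⟩ => ?_,
    Sierpinski.limsup_traceRoot_le, Sierpinski.isLUB_traceRoot⟩
  · rw [Sierpinski.exists_sobolevIneq_hausdorffHat_iff hp hpq hq]
    simp [Fin.exists_fin_two, le_antisymm_iff]
  · obtain ⟨h1, h2⟩ := Sierpinski.exists_exponents_kusuokaHat hp hpq h
    exact ⟨h1, Sierpinski.expoPos_one_le hp hpq, h2⟩
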